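/- Let $\mathcal S := [0,+\infty) + i(-1,1)\subset\mathbb C$. For $V\in L^1(\mathbb R)$ (complex-valued) and $\varepsilon\in\mathbb R$ let $H_\varepsilon = -\frac{d^2}{dx^2} + i\,\mathrm{sgn}(x) \,\dot{+}\, \varepsilon V$ be the operator in $L^2(\mathbb R)$ defined as a sum of forms, that is, the operator associated with the sesquilinear form $$h_\varepsilon(\psi,\phi) = \int_{\mathbb R}\psi'\bar\phi'\,dx + i\int_0^{\infty}\psi\bar\phi\,dx - i\int_{-\infty}^0\psi\bar\phi\,dx + \varepsilon\int_{\mathbb R}V\psi\bar\phi\,dx$$ on $\{\psi\in W^{1,2}(\mathbb R) : |V|^{1/2}\psi\in L^2(\mathbb R)\}$ $(=W^{1,2}(\mathbb R))$: a function $\psi$ of the form domain belongs to $\mathrm{Dom}(H_\varepsilon)$, with $H_\varepsilon\psi=\eta\in L^2(\mathbb R)$, if and only if $h_\varepsilon(\psi,\phi)=\int_{\mathbb R}\eta\bar\phi\,dx$ for all $\phi$ in the form domain. Let $\sigma_{\mathrm p}(H_\varepsilon)$ denote the set of eigenvalues of $H_\varepsilon$. (i) Let $n\ge 2$ be an integer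 and let $V\in L^1\big(\mathbb R,(1+x^{2n})\,dx\big)\cap W^{1,1}(\mathbb R)$. There exist positive constants $\varepsilon_0$ and $C$ (depending on $n$ and $V$) such that, for all $\varepsilon\in(0,\varepsilon_0)$, $$\sigma_{\mathrm p}(H_\varepsilon)\subset \overline{\mathcal S}\cap\Big\{z : \Re z\ge \frac{C}{\varepsilon^{2n}}\Big\}.$$ (ii) In particular, if $V$ belongs to the Schwartz space $\mathscr S(\mathbb R)$, then the eigenvalues escape to infinity faster than any power of $\varepsilon^{-1}$ as $\varepsilon\to0^+$: for every $N\in\mathbb N$ there exist positive constants $\varepsilon_0$ and $C$ such that, for all $\varepsilon\in(0,\varepsilon_0)$, every eigenvalue $\lambda$ of $H_\varepsilon$ is non-zero and satisfies $|\lambda|^{-1}\le C\,\varepsilon^{N}$. -/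

import Mathlib

open MeasureTheory Set
open scoped ENNReal ContDiff SchwartzMap ComplexConjugate

/-- The Hilbert space `L²(ℝ)` of complex-valued functions. -/
abbrev L2R : Type := Lp ℂ 2 (volume : Measure ℝ)

/-! ### Weak derivatives and the Sobolev spaces `W^{1,p}(ℝ)` -/

/-- `g` is a weak derivative of `f` on `ℝ` (tested against `C_c^∞(ℝ)`). -/
def HasWeakDeriv (f g : ℝ → ℂ) : Prop :=
  LocallyIntegrable f ∧ LocallyIntegrable g ∧
    ∀ φ : ℝ → ℝ, ContDiff ℝ ∞ φ → HasCompactSupport φ →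
      ∫ x, deriv φ x • f x = - ∫ x, φ x • g x

open Classical in
/-- The weak derivative of `f` (unique up to a.e. equality), and `0` if there is none. -/
noncomputable def weakDeriv (f : ℝ → ℂ) : ℝ → ℂ :=
  if h : ∃ g, HasWeakDeriv f g then Classical.choose h else 0

/-- `f ∈ W^{1,p}(ℝ)`. -/
def MemW1 (p : ℝ≥0∞) (f : ℝ → ℂ) : Prop :=
  MemLp f p ∧ ∃ g : ℝ → ℂ, HasWeakDeriv f g ∧ MemLp g p

theorem HasWeakDeriv.unique {f g₁ g₂ : ℝ → ℂ} (h₁ : HasWeakDeriv f g₁)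
    (h₂ : HasWeakDeriv f g₂) : g₁ =ᵐ[volume] g₂ := by
  refine ae_eq_of_integral_contDiff_smul_eq h₁.2.1 h₂.2.1 fun φ hφ hc => ?_
  have e₁ := h₁.2.2 φ hφ hc
  have e₂ := h₂.2.2 φ hφ hc
  exact neg_injective (e₁.symm.trans e₂)

theorem HasWeakDeriv.congr {f f' g : ℝ → ℂ} (h : HasWeakDeriv f g)
    (hf : f =ᵐ[volume] f') : HasWeakDeriv f' g := by
  refine ⟨h.1.congr hf, h.2.1, fun φ hφ hc => ?_⟩
  rw [← h.2.2 φ hφ hc]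
  refine integral_congr_ae ?_
  filter_upwards [hf] with x hx
  rw [hx]

theorem HasWeakDeriv.add {f₁ f₂ g₁ g₂ : ℝ → ℂ} (h₁ : HasWeakDeriv f₁ g₁)
    (h₂ : HasWeakDeriv f₂ g₂) : HasWeakDeriv (f₁ + f₂) (g₁ + g₂) := by
  refine ⟨h₁.1.add h₂.1, h₁.2.1.add h₂.2.1, fun φ hφ hc => ?_⟩
  have hd : Continuous (deriv φ) := hφ.continuous_deriv (by simp)
  simp only [Pi.add_apply, smul_add]
  rw [integral_add (h₁.1.integrable_smul_left_of_hasCompactSupport hd hc.deriv)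
      (h₂.1.integrable_smul_left_of_hasCompactSupport hd hc.deriv),
    integral_add (h₁.2.1.integrable_smul_left_of_hasCompactSupport hφ.continuous hc)
      (h₂.2.1.integrable_smul_left_of_hasCompactSupport hφ.continuous hc),
    h₁.2.2 φ hφ hc, h₂.2.2 φ hφ hc, neg_add]

theorem HasWeakDeriv.const_smul {f g : ℝ → ℂ} (c : ℂ) (h : HasWeakDeriv f g) :
    HasWeakDeriv (c • f) (c • g) := by
  refine ⟨h.1.smul c, h.2.1.smul c, fun φ hφ hc => ?_⟩
  simp only [Pi.smul_apply, smul_comm _ c]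
  rw [integral_smul, integral_smul, h.2.2 φ hφ hc, smul_neg]

theorem HasWeakDeriv.weakDeriv_ae_eq {f g : ℝ → ℂ} (h : HasWeakDeriv f g) :
    weakDeriv f =ᵐ[volume] g := by
  have hex : ∃ g, HasWeakDeriv f g := ⟨g, h⟩
  rw [weakDeriv, dif_pos hex]
  exact (Classical.choose_spec hex).unique h

/-- A smooth function is weakly differentiable. -/
theorem hasWeakDeriv_of_contDiff (u : ℝ → ℝ) (hu : ContDiff ℝ ∞ u) :
    HasWeakDeriv (fun x => (u x : ℂ)) (fun x => ((deriv u x : ℝ) : ℂ)) := by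
  have hd : Continuous (deriv u) := hu.continuous_deriv (by simp)
  refine ⟨(Complex.continuous_ofReal.comp hu.continuous).locallyIntegrable,
    (Complex.continuous_ofReal.comp hd).locallyIntegrable, fun φ hφ hc => ?_⟩
  have hdφ : Continuous (deriv φ) := hφ.continuous_deriv (by simp)
  have hφd : ∀ x, HasDerivAt φ (deriv φ x) x := fun x =>
    (hφ.differentiable (by simp) x).hasDerivAt
  have hud : ∀ x, HasDerivAt u (deriv u x) x := fun x =>
    (hu.differentiable (by simp) x).hasDerivAt
  have key := integral_mul_deriv_eq_deriv_mul_of_integrable (u := u) (v := φ)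
    (u' := deriv u) (v' := deriv φ) (fun x _ => hud x) (fun x _ => hφd x)
    ((hu.continuous.mul hdφ).integrable_of_hasCompactSupport (hc.deriv.mul_left))
    ((hd.mul hφ.continuous).integrable_of_hasCompactSupport (hc.mul_left))
    ((hu.continuous.mul hφ.continuous).integrable_of_hasCompactSupport (hc.mul_left))
  simp only [Complex.real_smul, ← Complex.ofReal_mul, integral_complex_ofReal]
  simp only [mul_comm (deriv φ _), mul_comm (φ _)]
  rw [key, Complex.ofReal_neg]

theorem MemW1.congr {p : ℝ≥0∞} {f f' : ℝ → ℂ} (h : MemW1 p f) (hf : f =ᵐ[volume] f') :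
    MemW1 p f' := by
  obtain ⟨h1, g, hg, hgp⟩ := h
  exact ⟨h1.ae_eq hf, g, hg.congr hf, hgp⟩

theorem MemW1.memLp_weakDeriv {p : ℝ≥0∞} {f : ℝ → ℂ} (h : MemW1 p f) :
    HasWeakDeriv f (weakDeriv f) ∧ MemLp (weakDeriv f) p := by
  obtain ⟨-, g, hg, hgp⟩ := h
  have hex : ∃ g, HasWeakDeriv f g := ⟨g, hg⟩
  refine ⟨?_, hgp.ae_eq hg.weakDeriv_ae_eq.symm⟩
  rw [weakDeriv, dif_pos hex]
  exact Classical.choose_spec hex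

/-! ### The sesquilinear form of the perturbed operator -/

/-- The form domain `W^{1,2}(ℝ) ∩ {ψ ∈ L²(ℝ) : |V|^{1/2} ψ ∈ L²(ℝ)}`. -/
noncomputable def formDomain (V : ℝ → ℂ) : Submodule ℂ L2R where
  carrier := {ψ | MemW1 2 ψ ∧ MemLp (fun x => (Real.sqrt ‖V x‖ : ℂ) * ψ x) 2}
  zero_mem' := by
    have h0 : (fun _ => 0 : ℝ → ℂ) =ᵐ[volume] ((0 : L2R) : ℝ → ℂ) :=
      (Lp.coeFn_zero ℂ 2 volume).symm
    refine ⟨MemW1.congr (f := fun _ => 0) ⟨MemLp.zero', fun _ => 0, ⟨?_, ?_, ?_⟩, MemLp.zero'⟩ h0,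
      MemLp.ae_eq ?_ (MemLp.zero' : MemLp (fun _ => (0 : ℂ)) 2 (volume : Measure ℝ))⟩
    · exact locallyIntegrable_zero
    · exact locallyIntegrable_zero
    · intros; simp
    · filter_upwards [h0] with x hx
      simp
  add_mem' := by
    rintro ψ₁ ψ₂ ⟨⟨_, g₁, hg₁, hp₁⟩, hv₁⟩ ⟨⟨_, g₂, hg₂, hp₂⟩, hv₂⟩
    refine ⟨⟨Lp.memLp _, g₁ + g₂, (hg₁.add hg₂).congr (Lp.coeFn_add ψ₁ ψ₂).symm, hp₁.add hp₂⟩,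
      (hv₁.add hv₂).ae_eq ?_⟩
    filter_upwards [Lp.coeFn_add ψ₁ ψ₂] with x hx
    simp only [hx, Pi.add_apply]
    ring
  smul_mem' := by
    rintro c ψ ⟨⟨_, g, hg, hp⟩, hv⟩
    refine ⟨⟨Lp.memLp _, c • g, (hg.const_smul c).congr (Lp.coeFn_smul c ψ).symm,
      hp.const_smul c⟩, (hv.const_smul c).ae_eq ?_⟩
    filter_upwards [Lp.coeFn_smul c ψ] with x hx
    simp only [Pi.smul_apply, hx, smul_eq_mul]
    ring

/-- The sesquilinear form
`h_ε(ψ, φ) = ∫ ψ' φ̄' + i ∫_0^∞ ψ φ̄ - i ∫_{-∞}^0 ψ φ̄ + ε ∫ V ψ φ̄`. -/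
noncomputable def perturbedForm (V : ℝ → ℂ) (ε : ℝ) (ψ φ : L2R) : ℂ :=
  (∫ x, weakDeriv ψ x * conj (weakDeriv φ x))
    + Complex.I * (∫ x in Ioi 0, ψ x * conj (φ x))
    - Complex.I * (∫ x in Iio 0, ψ x * conj (φ x))
    + ε * ∫ x, V x * ψ x * conj (φ x)

theorem integrable_mul_conj {f g : ℝ → ℂ} (hf : MemLp f 2) (hg : MemLp g 2) :
    Integrable (fun x => f x * conj (g x)) :=
  MemLp.integrable_mul hf hg.star

theorem integrable_potential {V : ℝ → ℂ} (hV : AEStronglyMeasurable V) {ψ φ : L2R}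
    (hψ : ψ ∈ formDomain V) (hφ : φ ∈ formDomain V) :
    Integrable (fun x => V x * ψ x * conj (φ x)) := by
  refine (integrable_mul_conj hψ.2 hφ.2).mono
    ((hV.mul (Lp.aestronglyMeasurable ψ)).mul (Lp.aestronglyMeasurable φ).star) ?_
  refine Filter.Eventually.of_forall fun x => le_of_eq ?_
  simp only [norm_mul, RCLike.norm_conj, Complex.norm_real, Real.norm_eq_abs,
    abs_of_nonneg (Real.sqrt_nonneg _)]
  have := Real.mul_self_sqrt (norm_nonneg (V x))
  linear_combination (-‖ψ x‖ * ‖φ x‖) * this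

theorem perturbedForm_add {V : ℝ → ℂ} (hV : AEStronglyMeasurable V) (ε : ℝ) {ψ₁ ψ₂ φ : L2R}
    (h₁ : ψ₁ ∈ formDomain V) (h₂ : ψ₂ ∈ formDomain V) (hφ : φ ∈ formDomain V) :
    perturbedForm V ε (ψ₁ + ψ₂) φ = perturbedForm V ε ψ₁ φ + perturbedForm V ε ψ₂ φ := by
  have d₁ := h₁.1.memLp_weakDeriv
  have d₂ := h₂.1.memLp_weakDeriv
  have dφ := hφ.1.memLp_weakDeriv
  have hw : weakDeriv (ψ₁ + ψ₂ : L2R) =ᵐ[volume] weakDeriv ψ₁ + weakDeriv ψ₂ :=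
    ((d₁.1.add d₂.1).congr (Lp.coeFn_add ψ₁ ψ₂).symm).weakDeriv_ae_eq
  have hc := Lp.coeFn_add ψ₁ ψ₂
  have i₁ := integrable_mul_conj (Lp.memLp ψ₁) (Lp.memLp φ)
  have i₂ := integrable_mul_conj (Lp.memLp ψ₂) (Lp.memLp φ)
  have e₁ : ∫ x, weakDeriv (ψ₁ + ψ₂ : L2R) x * conj (weakDeriv φ x)
      = (∫ x, weakDeriv ψ₁ x * conj (weakDeriv φ x))
        + ∫ x, weakDeriv ψ₂ x * conj (weakDeriv φ x) := by
    rw [← integral_add (integrable_mul_conj d₁.2 dφ.2) (integrable_mul_conj d₂.2 dφ.2)]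
    refine integral_congr_ae ?_
    filter_upwards [hw] with x hx
    simp only [hx, Pi.add_apply]
    ring
  have e₂ : ∀ s : Set ℝ, ∫ x in s, (ψ₁ + ψ₂ : L2R) x * conj (φ x)
      = (∫ x in s, ψ₁ x * conj (φ x)) + ∫ x in s, ψ₂ x * conj (φ x) := fun s => by
    rw [← integral_add i₁.integrableOn i₂.integrableOn]
    refine integral_congr_ae (ae_restrict_of_ae ?_)
    filter_upwards [hc] with x hx
    simp only [hx, Pi.add_apply]
    ring
  have e₃ : ∫ x, V x * (ψ₁ + ψ₂ : L2R) x * conj (φ x)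
      = (∫ x, V x * ψ₁ x * conj (φ x)) + ∫ x, V x * ψ₂ x * conj (φ x) := by
    rw [← integral_add (integrable_potential hV h₁ hφ) (integrable_potential hV h₂ hφ)]
    refine integral_congr_ae ?_
    filter_upwards [hc] with x hx
    simp only [hx, Pi.add_apply]
    ring
  simp only [perturbedForm, e₁, e₂, e₃]
  ring

theorem perturbedForm_smul {V : ℝ → ℂ} (ε : ℝ) (c : ℂ) {ψ φ : L2R} (h : ψ ∈ formDomain V) :
    perturbedForm V ε (c • ψ) φ = c * perturbedForm V ε ψ φ := by
  have d := h.1.memLp_weakDeriv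
  have hw : weakDeriv (c • ψ : L2R) =ᵐ[volume] c • weakDeriv ψ :=
    ((d.1.const_smul c).congr (Lp.coeFn_smul c ψ).symm).weakDeriv_ae_eq
  have hc := Lp.coeFn_smul c ψ
  have e₁ : ∫ x, weakDeriv (c • ψ : L2R) x * conj (weakDeriv φ x)
      = c * ∫ x, weakDeriv ψ x * conj (weakDeriv φ x) := by
    rw [← integral_const_mul]
    refine integral_congr_ae ?_
    filter_upwards [hw] with x hx
    simp [hx, mul_assoc]
  have e₂ : ∀ s : Set ℝ, ∫ x in s, (c • ψ : L2R) x * conj (φ x)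
      = c * ∫ x in s, ψ x * conj (φ x) := fun s => by
    rw [← integral_const_mul]
    refine integral_congr_ae (ae_restrict_of_ae ?_)
    filter_upwards [hc] with x hx
    simp [hx, mul_assoc]
  have e₃ : ∫ x, V x * (c • ψ : L2R) x * conj (φ x)
      = c * ∫ x, V x * ψ x * conj (φ x) := by
    rw [← integral_const_mul]
    refine integral_congr_ae ?_
    filter_upwards [hc] with x hx
    simp only [hx, Pi.smul_apply, smul_eq_mul]
    ring
  simp only [perturbedForm, e₁, e₂, e₃]
  ring

/-! ### The operator `H_ε` associated with the form -/

/-- The graph of the operator associated with `h_ε`: the pairs `(ψ, η)` with `ψ` in the form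
domain, `η ∈ L²(ℝ)` and `h_ε(ψ, φ) = (η, φ)` for all `φ` in the form domain, where
`(η, φ) = ∫ η φ̄` (Mathlib's inner product is linear in its second argument). -/
noncomputable def perturbedGraph (V : Lp ℂ 1 (volume : Measure ℝ)) (ε : ℝ) :
    Submodule ℂ (L2R × L2R) where
  carrier := {p | p.1 ∈ formDomain V ∧
    ∀ φ ∈ formDomain V, perturbedForm V ε p.1 φ = inner ℂ φ p.2}
  zero_mem' := by
    refine ⟨zero_mem _, fun φ _ => ?_⟩
    have := perturbedForm_smul (V := V) (φ := φ) ε 0 (zero_mem _)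
    simpa using this
  add_mem' := by
    rintro p q ⟨hp, hp'⟩ ⟨hq, hq'⟩
    refine ⟨add_mem hp hq, fun φ hφ => ?_⟩
    rw [Prod.fst_add, Prod.snd_add,
      perturbedForm_add (Lp.aestronglyMeasurable V) ε hp hq hφ, hp' φ hφ, hq' φ hφ, inner_add_right]
  smul_mem' := by
    rintro c p ⟨hp, hp'⟩
    refine ⟨Submodule.smul_mem _ c hp, fun φ hφ => ?_⟩
    rw [Prod.smul_fst, Prod.smul_snd, perturbedForm_smul ε c hp, hp' φ hφ, inner_smul_right]

/-- Smooth compactly supported functions lie in the form domain. -/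
theorem toLp_mem_formDomain (V : Lp ℂ 1 (volume : Measure ℝ)) {u : ℝ → ℝ}
    (hu : ContDiff ℝ ∞ u) (hc : HasCompactSupport u)
    (hL : MemLp (fun x => (u x : ℂ)) 2 (volume : Measure ℝ)) :
    hL.toLp _ ∈ formDomain V := by
  have hd : Continuous (deriv u) := hu.continuous_deriv (by simp)
  have hw := (hasWeakDeriv_of_contDiff u hu).congr hL.coeFn_toLp.symm
  have hm : MemLp (fun x => ((deriv u x : ℝ) : ℂ)) 2 (volume : Measure ℝ) :=
    (Complex.continuous_ofReal.comp hd).memLp_of_hasCompactSupport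
      (hc.deriv.comp_left Complex.ofReal_zero)
  refine ⟨⟨Lp.memLp _, _, hw, hm⟩, ?_⟩
  have hs : MemLp (fun x => (Real.sqrt ‖V x‖ : ℂ)) 2 (volume : Measure ℝ) := by
    have hV : Integrable V (volume : Measure ℝ) := memLp_one_iff_integrable.1 (Lp.memLp V)
    have hm : AEStronglyMeasurable (fun x => (Real.sqrt ‖V x‖ : ℂ)) (volume : Measure ℝ) :=
      (Complex.continuous_ofReal.comp Real.continuous_sqrt).comp_aestronglyMeasurable
        hV.aestronglyMeasurable.norm
    rw [memLp_two_iff_integrable_sq_norm hm]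
    refine hV.norm.congr (Filter.Eventually.of_forall fun x => ?_)
    simp [abs_of_nonneg (Real.sqrt_nonneg _)]
  have hb : MemLp (fun x => (u x : ℂ)) ∞ (volume : Measure ℝ) :=
    (Complex.continuous_ofReal.comp hu.continuous).memLp_of_hasCompactSupport
      (hc.comp_left Complex.ofReal_zero)
  refine (MemLp.mul (p := ∞) (q := 2) (r := 2) hs hb).ae_eq ?_
  filter_upwards [hL.coeFn_toLp] with x hx
  simp [hx, mul_comm]

/-- The graph is single-valued, i.e. it is the graph of an operator. -/
theorem perturbedGraph_single_valued (V : Lp ℂ 1 (volume : Measure ℝ)) (ε : ℝ)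
    (p : L2R × L2R) (hp : p ∈ perturbedGraph V ε) (h0 : p.1 = 0) : p.2 = 0 := by
  obtain ⟨-, hp'⟩ := hp
  have hform : ∀ φ ∈ formDomain V, inner ℂ φ p.2 = 0 := fun φ hφ => by
    rw [← hp' φ hφ, h0]
    have := perturbedForm_smul (V := V) (φ := φ) ε 0 (zero_mem _)
    simpa using this
  rw [Lp.eq_zero_iff_ae_eq_zero]
  refine ae_eq_zero_of_integral_contDiff_smul_eq_zero
    ((Lp.memLp p.2).locallyIntegrable one_le_two) fun u hu hc => ?_
  have hL : MemLp (fun x => (u x : ℂ)) 2 (volume : Measure ℝ) :=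
    (Complex.continuous_ofReal.comp hu.continuous).memLp_of_hasCompactSupport
      (hc.comp_left Complex.ofReal_zero)
  rw [← hform _ (toLp_mem_formDomain V hu hc hL), L2.inner_def]
  refine integral_congr_ae ?_
  filter_upwards [hL.coeFn_toLp] with x hx
  simp [hx, mul_comm]

/-- The operator `H_ε = H ∔ ε V`, `H = -d²/dx² + i sgn(x)`, in `L²(ℝ)`: the operator associated
with the form `h_ε`. -/
noncomputable def perturbedOperator (V : Lp ℂ 1 (volume : Measure ℝ)) (ε : ℝ) :
    L2R →ₗ.[ℂ] L2R :=
  (perturbedGraph V ε).toLinearPMap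

theorem perturbedOperator_graph (V : Lp ℂ 1 (volume : Measure ℝ)) (ε : ℝ) :
    (perturbedOperator V ε).graph = perturbedGraph V ε :=
  Submodule.toLinearPMap_graph_eq _ (perturbedGraph_single_valued V ε)

/-- The point spectrum (set of eigenvalues) of an operator in `L²(ℝ)`. -/
def pointSpectrum (T : L2R →ₗ.[ℂ] L2R) : Set ℂ :=
  {z | ∃ ψ : T.domain, (ψ : L2R) ≠ 0 ∧ T ψ = z • (ψ : L2R)}

/-- The half-strip `[0, ∞) + i (-1, 1)`. -/
def halfStrip : Set ℂ := {z | 0 ≤ z.re ∧ z.im ∈ Ioo (-1 : ℝ) 1}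

/-! For small `ε` the operator has no eigenvalue at all (`exists_pointSpectrum_eq_empty`), so both
assertions hold vacuously.

An eigenfunction has a representative `F` with absolutely continuous derivative solving `F'' = (±i -
z) F + ε V F`, with sign `+` on the right and `-` on the left
(`exists_solution_of_mem_pointSpectrum`). Reflecting the left half-line turns this into two problems
`F'' = k² F + ε w F` on `[0, ∞)`, with `k₁² = i - z`, `k₂² = -i - z` and `Re k ≥ 0`; the case `Re k
= 0` is allowed, so no position of `z` has to be excluded.

On one half-line, square integrability forces `F'(0) + k F(0) = -ε ∫ e^{-ky} w F`
(`boundary_condition`). For small `ε` the first moment of `w` gives `|F| ≤ 2 |F(0)|`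
(`norm_le_two_mul`), hence the right side is `O(ε) |F(0)|` uniformly in `k`. If moreover `w` is of
class `W^{1,1}`, replacing `F` by `e^{-ky} F(0)` and integrating by parts improves this to `O(ε)
|F(0)| / |k|` (`boundary_bound`).

Let `X` and `Y` be the left sides for the two half-lines. The slopes cancel, so `X + Y = (k₁ + k₂)
F(0)`, and multiplication by `k₁ - k₂` gives `(k₁ - k₂)(X + Y) = 2i F(0)`. By the two bounds the
left side is `O(ε) |F(0)|` uniformly in `z`: the jump `2i` of the potential cannot be compensated.
Hence `F(0) = 0` (`eq_zero_of_matching`), and `|F| ≤ 2 |F(0)|` yields `F = 0`. -/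

/-! ### Absolutely continuous primitives on an interval -/

/-- On `[a, b]` the function `F` is the primitive of the integrable function `g`. -/
def PrimitiveOn (F g : ℝ → ℂ) (a b : ℝ) : Prop :=
  IntervalIntegrable g volume a b ∧ ∀ x ∈ Icc a b, F x = F a + ∫ y in a..x, g y

/-- The primitive of a complex integrable function is absolutely continuous. -/
theorem IntervalIntegrable.absolutelyContinuousOnInterval_primitive {g : ℝ → ℂ} {a b : ℝ}
    (h : IntervalIntegrable g volume a b) :
    AbsolutelyContinuousOnInterval (fun x => ∫ y in a..x, g y) a b := by
  -- The real-valued primitive of `‖g‖` is absolutely continuous, and its increments dominate those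
  -- of the primitive of `g`.
  have hn := h.norm.absolutelyContinuousOnInterval_intervalIntegral (c := a) (by simp)
  unfold AbsolutelyContinuousOnInterval at hn ⊢
  refine squeeze_zero' (Filter.Eventually.of_forall fun _ => Finset.sum_nonneg fun _ _ =>
    dist_nonneg) ?_ hn
  rw [Filter.eventually_inf_principal]
  refine Filter.Eventually.of_forall fun E hE => Finset.sum_le_sum fun i hi => ?_
  obtain ⟨h1, h2⟩ := hE.1 i hi
  have i1 : ∀ y ∈ uIcc a b, IntervalIntegrable g volume a y := fun y hy =>
    h.mono_set (uIcc_subset_uIcc_left hy)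
  have j1 : ∀ y ∈ uIcc a b, IntervalIntegrable (fun x => ‖g x‖) volume a y := fun y hy =>
    h.norm.mono_set (uIcc_subset_uIcc_left hy)
  rw [dist_eq_norm, Real.dist_eq, intervalIntegral.integral_interval_sub_left (i1 _ h1) (i1 _ h2),
    intervalIntegral.integral_interval_sub_left (j1 _ h1) (j1 _ h2)]
  exact intervalIntegral.norm_integral_le_abs_integral_norm

namespace PrimitiveOn

variable {F G f g : ℝ → ℂ} {a b : ℝ}

theorem continuousOn (h : PrimitiveOn F g a b) (hab : a ≤ b) : ContinuousOn F (Icc a b) := by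
  have h1 := h.1.absolutelyContinuousOnInterval_primitive.continuousOn
  rw [uIcc_of_le hab] at h1
  exact (continuousOn_const.add h1).congr h.2

theorem add (hF : PrimitiveOn F f a b) (hG : PrimitiveOn G g a b) :
    PrimitiveOn (fun x => F x + G x) (fun x => f x + g x) a b := by
  refine ⟨hF.1.add hG.1, fun x hx => ?_⟩
  have hs : uIcc a x ⊆ uIcc a b := by
    rw [uIcc_of_le hx.1, uIcc_of_le (hx.1.trans hx.2)]
    exact Icc_subset_Icc_right hx.2
  rw [intervalIntegral.integral_add (hF.1.mono_set hs) (hG.1.mono_set hs)]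
  linear_combination hF.2 x hx + hG.2 x hx

theorem congr_ae (h : PrimitiveOn F f a b) (hab : a ≤ b)
    (hfg : ∀ᵐ x, x ∈ Ioc a b → f x = g x) : PrimitiveOn F g a b := by
  refine ⟨h.1.congr_ae ?_, fun x hx => ?_⟩
  · rw [uIoc_of_le hab]
    exact (ae_restrict_iff' measurableSet_Ioc).2 hfg
  · rw [h.2 x hx]
    congr 1
    refine intervalIntegral.integral_congr_ae ?_
    filter_upwards [hfg] with y hy hyx
    rw [uIoc_of_le hx.1] at hyx
    exact hy ⟨hyx.1, hyx.2.trans hx.2⟩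

/-- Leibniz rule for the product of a primitive with a `C¹` function. -/
theorem mul_left (h : PrimitiveOn F g a b) (hab : a ≤ b) {u u' : ℝ → ℂ}
    (hu : ∀ x, HasDerivAt u (u' x) x) (hu' : Continuous u') :
    PrimitiveOn (fun x => u x * F x) (fun x => u' x * F x + u x * g x) a b := by
  have huc : Continuous u := continuous_iff_continuousAt.2 fun x => (hu x).continuousAt
  have hFc := h.continuousOn hab
  have hint : IntervalIntegrable (fun x => u' x * F x + u x * g x) volume a b := by
    refine IntervalIntegrable.add ?_ (h.1.continuousOn_mul huc.continuousOn)
    refine ContinuousOn.intervalIntegrable ?_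
    rw [uIcc_of_le hab]
    exact hu'.continuousOn.mul hFc
  refine ⟨hint, ?_⟩
  have hu1 : ContDiff ℝ 1 u := by
    rw [contDiff_one_iff_deriv]
    refine ⟨fun x => (hu x).differentiableAt, ?_⟩
    rwa [funext fun x => (hu x).deriv]
  -- The difference of the two sides is absolutely continuous with zero derivative almost
  -- everywhere, hence constant; its value at `a` identifies the constant.
  have hac : AbsolutelyContinuousOnInterval
      (fun x => u x * (F a + ∫ y in a..x, g y) - ∫ y in a..x, (u' y * F y + u y * g y)) a b := by
    refine AbsolutelyContinuousOnInterval.sub ?_ hint.absolutelyContinuousOnInterval_primitive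
    refine AbsolutelyContinuousOnInterval.smul (f := u)
      hu1.contDiffOn.absolutelyContinuousOnInterval ?_
    refine AbsolutelyContinuousOnInterval.add (f := fun _ => F a) ?_
      h.1.absolutelyContinuousOnInterval_primitive
    exact contDiffOn_const.absolutelyContinuousOnInterval
  have hd : ∀ᵐ x, x ∈ uIcc a b → HasDerivAt
      (fun x => u x * (F a + ∫ y in a..x, g y) - ∫ y in a..x, (u' y * F y + u y * g y)) 0 x := by
    filter_upwards [h.1.ae_hasDerivAt_integral, hint.ae_hasDerivAt_integral] with x h1 h2 hx
    have e1 := (hu x).mul ((h1 hx a (by simp)).const_add (F a))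
    have e2 := e1.sub (h2 hx a (by simp))
    rw [uIcc_of_le hab] at hx
    rw [← h.2 x hx, sub_self] at e2
    exact e2
  obtain ⟨C, hC⟩ := hac.const_of_ae_hasDerivAt_zero hd
  rw [uIcc_of_le hab] at hC
  have h0 := hC a (left_mem_Icc.2 hab)
  simp only [intervalIntegral.integral_same, add_zero, sub_zero] at h0
  intro x hx
  have h1 := hC x hx
  rw [← h.2 x hx] at h1
  linear_combination h1 - h0

/-- Reflection `x ↦ -x`. -/
theorem comp_neg (h : PrimitiveOn F g (-b) (-a)) :
    PrimitiveOn (fun x => F (-x)) (fun x => -g (-x)) a b := by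
  refine ⟨?_, fun x hx => ?_⟩
  · have e := ((IntervalIntegrable.iff_comp_neg).1 h.1).symm.neg
    simp only [neg_neg] at e
    exact e
  · have hl : -b ≤ -a := by linarith [hx.1, hx.2]
    have h1 := h.2 (-x) ⟨by linarith [hx.2], by linarith [hx.1]⟩
    have h2 := h.2 (-a) ⟨hl, le_rfl⟩
    have i1 : IntervalIntegrable g volume (-b) (-x) := h.1.mono_set (by
      rw [uIcc_of_le hl, uIcc_of_le (by linarith [hx.2])]
      exact Icc_subset_Icc_right (by linarith [hx.1]))
    have := intervalIntegral.integral_interval_sub_left h.1 i1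
    rw [intervalIntegral.integral_neg, intervalIntegral.integral_comp_neg g, ← this]
    linear_combination h1 - h2

end PrimitiveOn

/-! ### Absolutely continuous representatives of weakly differentiable functions -/

/-- Primitive of a test function with vanishing integral. -/
theorem exists_hasCompactSupport_primitive {θ : ℝ → ℝ} (hθ : ContDiff ℝ ∞ θ)
    (hc : HasCompactSupport θ) (h0 : ∫ x, θ x = 0) :
    ∃ Θ : ℝ → ℝ, ContDiff ℝ ∞ Θ ∧ HasCompactSupport Θ ∧ deriv Θ = θ := by
  obtain ⟨R, hR⟩ := hc.isCompact.isBounded.subset_closedBall 0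
  have hz : ∀ x, R < |x| → θ x = 0 := fun x hx => by
    by_contra hne
    have := hR (subset_tsupport _ hne)
    rw [Metric.mem_closedBall, dist_zero_right, Real.norm_eq_abs] at this
    linarith
  have hd : ∀ x, HasDerivAt (fun x => ∫ y in Iic x, θ y) (θ x) x := fun x => by
    have hi : Integrable θ := hθ.continuous.integrable_of_hasCompactSupport hc
    have e : (fun x => ∫ y in Iic x, θ y) = fun x => (∫ y in Iic 0, θ y) + ∫ y in (0:ℝ)..x, θ y := by
      funext x
      rw [← intervalIntegral.integral_Iic_sub_Iic hi.integrableOn hi.integrableOn]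
      ring
    rw [e]
    exact (intervalIntegral.integral_hasDerivAt_right (hθ.continuous.intervalIntegrable _ _)
      (hθ.continuous.stronglyMeasurableAtFilter _ _) hθ.continuous.continuousAt).const_add _
  have hde : deriv (fun x => ∫ y in Iic x, θ y) = θ := funext fun x => (hd x).deriv
  refine ⟨fun x => ∫ y in Iic x, θ y, ?_, ?_, hde⟩
  · rw [contDiff_infty_iff_deriv, hde]
    exact ⟨fun x => (hd x).differentiableAt, hθ⟩
  -- To the left of the support the integrand vanishes; to the right the primitive equals the total
  -- integral, which is `0`.
  · refine HasCompactSupport.intro (isCompact_Icc (a := -|R|) (b := |R|)) fun x hx => ?_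
    rw [mem_Icc, not_and_or, not_le, not_le] at hx
    have hR' := le_abs_self R
    rcases hx with hx | hx
    · refine setIntegral_eq_zero_of_forall_eq_zero fun y hy => hz y ?_
      rw [mem_Iic] at hy
      linarith [neg_abs_le y]
    · rw [← h0]
      refine setIntegral_eq_integral_of_forall_compl_eq_zero fun y hy => hz y ?_
      rw [mem_Iic, not_le] at hy
      linarith [le_abs_self y]

/-- A locally integrable function with zero weak derivative is a.e. constant. -/
theorem ae_eq_const_of_integral_deriv_smul_eq_zero {h : ℝ → ℂ} (hh : LocallyIntegrable h)
    (h0 : ∀ φ : ℝ → ℝ, ContDiff ℝ ∞ φ → HasCompactSupport φ → ∫ x, deriv φ x • h x = 0) :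
    ∃ c : ℂ, h =ᵐ[volume] fun _ => c := by
  -- With `ρ` of unit mass, `φ - (∫ φ) ρ` has mean zero, so it is the derivative of a test function
  -- and `h` annihilates it. This gives `∫ φ h = (∫ φ) ∫ ρ h`, so the constant is `∫ ρ h`.
  let β : ContDiffBump (0 : ℝ) := default
  let ρ : ℝ → ℝ := β.normed volume
  have hρ : ContDiff ℝ ∞ ρ := β.contDiff_normed
  have hρc : HasCompactSupport ρ := β.hasCompactSupport_normed
  have hρi : ∫ x, ρ x = 1 := β.integral_normed
  refine ⟨∫ x, ρ x • h x, ?_⟩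
  refine ae_eq_of_integral_contDiff_smul_eq hh (locallyIntegrable_const _) fun φ hφ hφc => ?_
  have hφi : Integrable φ := hφ.continuous.integrable_of_hasCompactSupport hφc
  have hρi' : Integrable ρ := hρ.continuous.integrable_of_hasCompactSupport hρc
  obtain ⟨Θ, hΘ, hΘc, hΘd⟩ := exists_hasCompactSupport_primitive
    (θ := fun x => φ x - (∫ y, φ y) * ρ x) (hφ.sub (contDiff_const.mul hρ))
    (hφc.sub hρc.mul_left) (by
      rw [integral_sub hφi (hρi'.const_mul _), integral_const_mul, hρi, mul_one, sub_self])
  have key := h0 Θ hΘ hΘc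
  rw [hΘd] at key
  simp only [sub_smul, mul_smul] at key
  have hρh : Integrable (fun x => (∫ y, φ y) • ρ x • h x) :=
    (hh.integrable_smul_left_of_hasCompactSupport hρ.continuous hρc).smul (∫ y, φ y)
  rw [integral_sub (hh.integrable_smul_left_of_hasCompactSupport hφ.continuous hφc) hρh,
    integral_smul, sub_eq_zero] at key
  rw [key, integral_smul_const]

/-- If `G` is a primitive of `g`, the Leibniz rule shows that `f - G` has zero weak derivative, so
it is a constant `c`; take `F = G + c`. -/
theorem HasWeakDeriv.exists_primitive {f g : ℝ → ℂ} (h : HasWeakDeriv f g) :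
    ∃ F : ℝ → ℂ, f =ᵐ[volume] F ∧ Continuous F ∧ ∀ a b, a ≤ b → PrimitiveOn F g a b := by
  have hgi : ∀ a b, IntervalIntegrable g volume a b := fun a b =>
    (h.2.1.integrableOn_isCompact isCompact_uIcc).intervalIntegrable
  let G : ℝ → ℂ := fun x => ∫ y in (0:ℝ)..x, g y
  have hG : Continuous G := intervalIntegral.continuous_primitive hgi 0
  have hGp : ∀ (c : ℂ) a b, PrimitiveOn (fun x => G x + c) g a b := fun c a b => by
    refine ⟨hgi a b, fun x _ => ?_⟩
    simp only [G]
    rw [← intervalIntegral.integral_add_adjacent_intervals (hgi 0 a) (hgi a x)]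
    ring
  obtain ⟨c, hc⟩ := ae_eq_const_of_integral_deriv_smul_eq_zero (h := fun x => f x - G x)
    (h.1.sub hG.locallyIntegrable) (fun φ hφ hφc => by
      have hdφ : Continuous (deriv φ) := hφ.continuous_deriv (by simp)
      simp only [smul_sub]
      rw [integral_sub (h.1.integrable_smul_left_of_hasCompactSupport hdφ hφc.deriv)
        (hG.locallyIntegrable.integrable_smul_left_of_hasCompactSupport hdφ hφc.deriv),
        h.2.2 φ hφ hφc, sub_eq_zero]
      symm
      obtain ⟨R, hR⟩ := hφc.isCompact.isBounded.subset_closedBall 0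
      have hz : ∀ x, x ∉ Icc (-|R|) |R| → φ x = 0 ∧ deriv φ x = 0 := fun x hx => by
        have hx' : x ∉ tsupport φ := fun hmem => hx (by
          have := hR hmem
          rw [Metric.mem_closedBall, dist_zero_right, Real.norm_eq_abs] at this
          exact abs_le.1 (this.trans (le_abs_self R)))
        exact ⟨image_eq_zero_of_notMem_tsupport hx',
          image_eq_zero_of_notMem_tsupport fun h' => hx' (tsupport_deriv_subset h')⟩
      -- The margin `1` puts both endpoints outside the support of `φ`, so the boundary terms of the
      -- integration by parts vanish.
      have hRR : -(|R| + 1) ≤ |R| + 1 := by linarith [abs_nonneg R]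
      have hp := (PrimitiveOn.mul_left (hGp 0 (-(|R| + 1)) (|R| + 1)) hRR
        (u := fun x => (φ x : ℂ)) (u' := fun x => ((deriv φ x : ℝ) : ℂ))
        (fun x => ((hφ.differentiable (by simp) x).hasDerivAt).ofReal_comp)
        (Complex.continuous_ofReal.comp hdφ)).2 (|R| + 1) ⟨hRR, le_rfl⟩
      have z1 : φ (|R| + 1) = 0 := (hz _ fun h' => by linarith [h'.2]).1
      have z2 : φ (-(|R| + 1)) = 0 := (hz _ fun h' => by linarith [h'.1]).1
      simp only [z1, z2, Complex.ofReal_zero, zero_mul, zero_add, add_zero] at hp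
      rw [intervalIntegral.integral_of_le hRR, setIntegral_eq_integral_of_forall_compl_eq_zero]
        at hp
      · rw [integral_add] at hp
        · simp only [Complex.real_smul]
          linear_combination -hp
        · simpa only [Complex.real_smul] using
            hG.locallyIntegrable.integrable_smul_left_of_hasCompactSupport hdφ hφc.deriv
        · simpa only [Complex.real_smul] using
            h.2.1.integrable_smul_left_of_hasCompactSupport hφ.continuous hφc
      · intro x hx
        obtain ⟨e1, e2⟩ := hz x fun h' => hx ⟨by linarith [h'.1], by linarith [h'.2]⟩
        simp [e1, e2])
  refine ⟨fun x => G x + c, ?_, hG.add continuous_const, fun a b _ => hGp c a b⟩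
  filter_upwards [hc] with x hx
  rw [← hx]
  ring

/-! ### Square-integrable solutions of `F'' = k² F + q F` on the half-line -/

theorem norm_cexp_neg_mul_le_one {k : ℂ} (hk : 0 ≤ k.re) {x : ℝ} (hx : 0 ≤ x) :
    ‖Complex.exp (-(k * x))‖ ≤ 1 := by
  rw [Complex.norm_exp, Real.exp_le_one_iff]
  simpa using mul_nonneg hk hx

theorem hasDerivAt_cexp_mul (k : ℂ) (x : ℝ) :
    HasDerivAt (fun y : ℝ => Complex.exp (k * y)) (k * Complex.exp (k * x)) x := by
  have h := (((hasDerivAt_id (x : ℂ)).const_mul k).cexp).comp_ofReal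
  simpa [mul_comm] using h

theorem hasDerivAt_cexp_neg_mul (k : ℂ) (x : ℝ) :
    HasDerivAt (fun y : ℝ => Complex.exp (-(k * y))) (-(k * Complex.exp (-(k * x)))) x := by
  simpa using hasDerivAt_cexp_mul (-k) x

/-- `∫_0^x e^{-2ky} dy`. -/
noncomputable def expPrimitive (k : ℂ) (x : ℝ) : ℂ :=
  ∫ y in (0:ℝ)..x, Complex.exp (-(2 * k * y))

theorem hasDerivAt_expPrimitive (k : ℂ) (x : ℝ) :
    HasDerivAt (expPrimitive k) (Complex.exp (-(2 * k * x))) x := by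
  have hc : Continuous fun y : ℝ => Complex.exp (-(2 * k * y)) := by fun_prop
  exact intervalIntegral.integral_hasDerivAt_right (hc.intervalIntegrable _ _)
    (hc.stronglyMeasurableAtFilter _ _) hc.continuousAt

theorem norm_expPrimitive_le {k : ℂ} (hk : 0 ≤ k.re) {x : ℝ} (hx : 0 ≤ x) :
    ‖expPrimitive k x‖ ≤ x := by
  have h2 : 0 ≤ (2 * k).re := by simpa using hk
  have := intervalIntegral.norm_integral_le_of_norm_le_const (a := 0) (b := x) (C := 1)
    (f := fun y : ℝ => Complex.exp (-(2 * k * y))) fun y hy => by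
      rw [uIoc_of_le hx] at hy
      exact norm_cexp_neg_mul_le_one h2 hy.1.le
  simpa [expPrimitive, abs_of_nonneg hx] using this

theorem two_mul_mul_expPrimitive (k : ℂ) (x : ℝ) :
    2 * k * expPrimitive k x = 1 - Complex.exp (-(2 * k * x)) := by
  have := intervalIntegral.integral_eq_sub_of_hasDerivAt (a := 0) (b := x)
    (fun y _ => hasDerivAt_cexp_neg_mul (2 * k) y)
    ((by fun_prop : Continuous fun y : ℝ =>
      -(2 * k * Complex.exp (-(2 * k * y)))).intervalIntegrable _ _)
  rw [intervalIntegral.integral_neg, intervalIntegral.integral_const_mul] at this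
  simp only [Complex.ofReal_zero, mul_zero, neg_zero, Complex.exp_zero] at this
  rw [expPrimitive]
  linear_combination -this

/-- Complements `norm_expPrimitive_le`: the bound by `x` is uniform in `k` and costs a moment of the
potential, whereas this one needs only its mass and gains a factor `1 / |k|`. -/
theorem norm_expPrimitive_le_inv {k : ℂ} (hk : 0 ≤ k.re) (h0 : k ≠ 0) {x : ℝ} (hx : 0 ≤ x) :
    ‖expPrimitive k x‖ ≤ ‖k‖⁻¹ := by
  have h2 : 0 ≤ (2 * k).re := by simpa using hk
  have h3 : ‖2 * k * expPrimitive k x‖ ≤ 2 := by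
    rw [two_mul_mul_expPrimitive]
    calc _ ≤ ‖(1 : ℂ)‖ + ‖Complex.exp (-(2 * k * x))‖ := norm_sub_le _ _
      _ ≤ 1 + 1 := by
        gcongr
        · simp
        · exact norm_cexp_neg_mul_le_one h2 hx
      _ = 2 := by norm_num
  rw [norm_mul, norm_mul, RCLike.norm_ofNat] at h3
  rw [← one_div, le_div_iff₀ (norm_pos_iff.2 h0)]
  linarith

/-- `F` is a bounded `W^{1,2}` solution of `F'' = k² F + q F` on `[0, ∞)` with `F' = P`. -/
structure IsHalfLineSolution (k : ℂ) (q F P : ℝ → ℂ) : Prop where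
  re_nonneg : 0 ≤ k.re
  continuous_fst : Continuous F
  continuous_snd : Continuous P
  bounded : ∃ S, ∀ x, ‖F x‖ ≤ S
  primitive_fst : ∀ b, 0 ≤ b → PrimitiveOn F P 0 b
  primitive_snd : ∀ b, 0 ≤ b → PrimitiveOn P (fun x => k ^ 2 * F x + q x * F x) 0 b
  memLp_fst : MemLp F 2 (volume.restrict (Ioi 0))
  memLp_snd : MemLp P 2 (volume.restrict (Ioi 0))
  integrable : IntegrableOn q (Ioi 0)
  integrable_moment : IntegrableOn (fun x => x * ‖q x‖) (Ioi 0)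

namespace IsHalfLineSolution

variable {k : ℂ} {q F P : ℝ → ℂ}

theorem integrableOn_mul (h : IsHalfLineSolution k q F P) :
    IntegrableOn (fun x => q x * F x) (Ioi 0) := by
  obtain ⟨S, hS⟩ := h.bounded
  exact h.integrable.mul_bdd h.continuous_fst.aestronglyMeasurable
    (Filter.Eventually.of_forall hS)

theorem integrableOn_cexp_mul (h : IsHalfLineSolution k q F P) :
    IntegrableOn (fun x : ℝ => Complex.exp (-(k * x)) * (q x * F x)) (Ioi 0) := by
  refine h.integrableOn_mul.bdd_mul (c := 1)
    (by fun_prop : Continuous fun x : ℝ => Complex.exp (-(k * x))).aestronglyMeasurable ?_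
  exact (ae_restrict_iff' measurableSet_Ioi).2 (Filter.Eventually.of_forall fun x hx =>
    norm_cexp_neg_mul_le_one h.re_nonneg (le_of_lt hx))

/-- The equation factors as `(d/dx - k)(d/dx + k) F = q F`, so `e^{-kx}` is an integrating factor
for `P + k F`. -/
theorem primitiveOn_cexp_mul (h : IsHalfLineSolution k q F P) {b : ℝ} (hb : 0 ≤ b) :
    PrimitiveOn (fun x : ℝ => Complex.exp (-(k * x)) * (P x + k * F x))
      (fun x : ℝ => Complex.exp (-(k * x)) * (q x * F x)) 0 b := by
  have h1 := (h.primitive_fst b hb).mul_left hb (u := fun _ => k) (u' := fun _ => 0)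
    (fun x => hasDerivAt_const x k) continuous_const
  have h2 := ((h.primitive_snd b hb).add h1).mul_left hb (hasDerivAt_cexp_neg_mul k)
    (by fun_prop)
  refine h2.congr_ae hb (Filter.Eventually.of_forall fun x _ => ?_)
  ring

/-- The boundary condition at `0` satisfied by square-integrable solutions. -/
theorem boundary_condition (h : IsHalfLineSolution k q F P) :
    P 0 + k * F 0 = -∫ x in Ioi (0:ℝ), Complex.exp (-(k * x)) * (q x * F x) := by
  -- The derivative of `a` is integrable, so `a` has a limit at infinity; since `|a|²` is integrable
  -- on a half-line, that limit is `0`. This uses only `Re k ≥ 0`.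
  let a : ℝ → ℂ := fun x => Complex.exp (-(k * x)) * (P x + k * F x)
  have hlim : Filter.Tendsto a Filter.atTop (nhds (a 0 +
      ∫ x in Ioi (0:ℝ), Complex.exp (-(k * x)) * (q x * F x))) := by
    have := (intervalIntegral_tendsto_integral_Ioi 0 h.integrableOn_cexp_mul
      Filter.tendsto_id).const_add (a 0)
    refine this.congr' ?_
    filter_upwards [Filter.eventually_ge_atTop 0] with x hx
    exact ((h.primitiveOn_cexp_mul hx).2 x ⟨hx, le_rfl⟩).symm
  have hL2 : MemLp (fun x => P x + k * F x) 2 (volume.restrict (Ioi 0)) :=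
    h.memLp_snd.add (h.memLp_fst.const_mul k)
  have hcont : Continuous fun x => P x + k * F x :=
    h.continuous_snd.add (continuous_const.mul h.continuous_fst)
  have hi : IntegrableOn (fun x => ‖a x‖ ^ 2) (Ioi 0) := by
    have h1 := (memLp_two_iff_integrable_sq_norm hcont.aestronglyMeasurable).1 hL2
    refine h1.mono (Continuous.aestronglyMeasurable (by fun_prop)) ?_
    refine (ae_restrict_iff' measurableSet_Ioi).2 (Filter.Eventually.of_forall fun x hx => ?_)
    rw [norm_pow, norm_pow, norm_norm, norm_norm]
    gcongr
    simp only [a, norm_mul]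
    exact mul_le_of_le_one_left (norm_nonneg _)
      (norm_cexp_neg_mul_le_one h.re_nonneg (le_of_lt hx))
  have hz := IntegrableAtFilter.eq_zero_of_tendsto (l := Filter.atTop) (μ := volume)
    (f := fun x => ‖a x‖ ^ 2) ⟨Ioi 0, Filter.Ioi_mem_atTop 0, hi⟩ (fun s hs => by
      obtain ⟨c, hc⟩ := Filter.mem_atTop_sets.1 hs
      exact top_le_iff.1 (by simpa using measure_mono (μ := volume) (s := Ici c) hc))
    (hlim.norm.pow 2)
  rw [sq_eq_zero_iff, norm_eq_zero] at hz
  simp only [a, Complex.ofReal_zero, mul_zero, neg_zero, Complex.exp_zero, one_mul] at hz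
  linear_combination hz

theorem cexp_mul_eq (h : IsHalfLineSolution k q F P) {x : ℝ} (hx : 0 ≤ x) :
    Complex.exp (-(k * x)) * (P x + k * F x) =
      -∫ y in Ioi x, Complex.exp (-(k * y)) * (q y * F y) := by
  have h1 := (h.primitiveOn_cexp_mul hx).2 x ⟨hx, le_rfl⟩
  have h2 := h.boundary_condition
  have h3 := intervalIntegral.integral_Ioi_sub_Ioi h.integrableOn_cexp_mul hx
  simp only [Complex.ofReal_zero, mul_zero, neg_zero, Complex.exp_zero, one_mul] at h1
  linear_combination h1 + h2 - h3

/-- Undoing the factor `e^{-kx}` in `cexp_mul_eq` leaves the kernel `e^{-k(y-x)}`, of modulus at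
most `1` because the integral runs over `y > x`. -/
theorem norm_snd_add_le (h : IsHalfLineSolution k q F P) {x : ℝ} (hx : 0 ≤ x) :
    ‖P x + k * F x‖ ≤ ∫ y in Ioi x, ‖q y‖ * ‖F y‖ := by
  have e : P x + k * F x = -∫ y in Ioi x, Complex.exp (-(k * (y - x : ℝ))) * (q y * F y) := by
    have h1 : ∀ y : ℝ, Complex.exp (-(k * (y - x : ℝ))) * (q y * F y) =
        Complex.exp (k * x) * (Complex.exp (-(k * y)) * (q y * F y)) := fun y => by
      rw [← mul_assoc (Complex.exp (k * x)), ← Complex.exp_add]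
      congr 2
      push_cast
      ring
    simp only [h1]
    rw [integral_const_mul, ← mul_neg, ← h.cexp_mul_eq hx, ← mul_assoc, ← Complex.exp_add]
    simp
  rw [e, norm_neg]
  refine norm_integral_le_of_norm_le ?_ ?_
  · simpa only [norm_mul] using! (h.integrableOn_mul.mono_set (Ioi_subset_Ioi hx)).norm
  · refine (ae_restrict_iff' measurableSet_Ioi).2 (Filter.Eventually.of_forall fun y hy => ?_)
    rw [norm_mul, norm_mul]
    exact mul_le_of_le_one_left (by positivity)
      (norm_cexp_neg_mul_le_one h.re_nonneg (sub_nonneg.2 (le_of_lt hy)))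

/-- Variation of constants. -/
theorem sub_cexp_mul_eq (h : IsHalfLineSolution k q F P) {x : ℝ} (hx : 0 ≤ x) :
    F x - Complex.exp (-(k * x)) * F 0 = expPrimitive k x * (P x + k * F x) -
      ∫ y in (0:ℝ)..x, Complex.exp (-(k * (x - y : ℝ))) * expPrimitive k y * (q y * F y) := by
  have h1 := (h.primitive_fst x hx).mul_left hx (hasDerivAt_cexp_mul k) (by fun_prop)
  have hE : Continuous (expPrimitive k) :=
    continuous_iff_continuousAt.2 fun y => (hasDerivAt_expPrimitive k y).continuousAt
  -- Since `(e^{ky} F)' = e^{2ky} · e^{-ky}(P + k F)`, one integrates by parts using `e^{2ky}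
  -- expPrimitive k y`, the primitive of `e^{2ky}` vanishing at `0`. There is no division by `k`, so
  -- `k = 0` is covered.
  have hd : ∀ y : ℝ, HasDerivAt (fun y : ℝ => -(Complex.exp (2 * k * y) * expPrimitive k y))
      (-Complex.exp (2 * k * y)) y := fun y => by
    refine (((hasDerivAt_cexp_mul (2 * k) y).mul (hasDerivAt_expPrimitive k y)).congr_deriv ?_).neg
    linear_combination Complex.exp (2 * k * y) * two_mul_mul_expPrimitive k y
  have h2 := (h.primitiveOn_cexp_mul hx).mul_left hx hd (by fun_prop)
  have hexp : ∀ y : ℝ, Complex.exp (2 * k * y) * Complex.exp (-(k * y)) = Complex.exp (k * y) :=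
    fun y => by
      rw [← Complex.exp_add]
      ring_nf
  have hexp' : Complex.exp (-(k * x)) * Complex.exp (k * x) = 1 := by
    rw [← Complex.exp_add, neg_add_cancel, Complex.exp_zero]
  have h3 : PrimitiveOn (fun y : ℝ => Complex.exp (k * y) * F y +
      -(Complex.exp (2 * k * y) * expPrimitive k y) * (Complex.exp (-(k * y)) * (P y + k * F y)))
      (fun y : ℝ => -(Complex.exp (k * y) * expPrimitive k y * (q y * F y))) 0 x := by
    refine (h1.add h2).congr_ae hx (Filter.Eventually.of_forall fun y _ => ?_)
    linear_combination (-(P y + k * F y) - expPrimitive k y * (q y * F y)) * hexp y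
  have h4 := h3.2 x ⟨hx, le_rfl⟩
  have h0 : expPrimitive k 0 = 0 := by simp [expPrimitive]
  have h5 : ∫ y in (0:ℝ)..x, Complex.exp (-(k * (x - y : ℝ))) * expPrimitive k y * (q y * F y) =
      Complex.exp (-(k * x)) *
        ∫ y in (0:ℝ)..x, Complex.exp (k * y) * expPrimitive k y * (q y * F y) := by
    rw [← intervalIntegral.integral_const_mul]
    refine intervalIntegral.integral_congr fun y _ => ?_
    have : Complex.exp (-(k * (x - y : ℝ))) = Complex.exp (-(k * x)) * Complex.exp (k * y) := by
      rw [← Complex.exp_add]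
      congr 1
      push_cast
      ring
    simp only [this]
    ring
  rw [intervalIntegral.integral_neg] at h4
  simp only [h0, Complex.ofReal_zero, mul_zero, neg_zero, Complex.exp_zero, zero_mul, add_zero,
    one_mul] at h4
  rw [h5]
  linear_combination Complex.exp (-(k * x)) * h4 +
    Complex.exp (-(k * x)) * expPrimitive k x * (P x + k * F x) * hexp x +
    (expPrimitive k x * (P x + k * F x) - F x) * hexp'

/-- In the variation of constants formula the boundary term is a tail integral over `(x, ∞)`, under
which monotonicity lets `B x` be replaced by `B y`; the other term is an integral over `(0, x)`.
Together they give one integral over the half-line. It is applied with `B y = y` and with `B =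
‖k‖⁻¹`. -/
theorem norm_sub_cexp_mul_le (h : IsHalfLineSolution k q F P) {B : ℝ → ℝ}
    (hB : ∀ x, 0 ≤ x → ‖expPrimitive k x‖ ≤ B x) (hmono : Monotone B)
    (hBq : IntegrableOn (fun x => B x * ‖q x‖) (Ioi 0)) {S : ℝ} (hS : ∀ x, 0 ≤ x → ‖F x‖ ≤ S)
    {x : ℝ} (hx : 0 ≤ x) :
    ‖F x - Complex.exp (-(k * x)) * F 0‖ ≤ S * ∫ y in Ioi (0:ℝ), B y * ‖q y‖ := by
  have hB0 : ∀ y, 0 ≤ y → 0 ≤ B y := fun y hy => (norm_nonneg _).trans (hB y hy)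
  have hS0 : 0 ≤ S := (norm_nonneg _).trans (hS 0 le_rfl)
  have hBS : IntegrableOn (fun y => S * (B y * ‖q y‖)) (Ioi 0) := hBq.const_mul S
  have hBSx : IntegrableOn (fun y => S * (B y * ‖q y‖)) (Ioi x) :=
    hBS.mono_set (Ioi_subset_Ioi hx)
  have hqF : IntegrableOn (fun y => ‖q y‖ * ‖F y‖) (Ioi x) := by
    simpa only [norm_mul] using! (h.integrableOn_mul.mono_set (Ioi_subset_Ioi hx)).norm
  have t1 : ‖expPrimitive k x * (P x + k * F x)‖ ≤ ∫ y in Ioi x, S * (B y * ‖q y‖) := by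
    rw [norm_mul]
    calc _ ≤ B x * ∫ y in Ioi x, ‖q y‖ * ‖F y‖ := by
          gcongr
          · exact hB0 x hx
          · exact hB x hx
          · exact h.norm_snd_add_le hx
      _ = ∫ y in Ioi x, B x * (‖q y‖ * ‖F y‖) := (integral_const_mul _ _).symm
      _ ≤ _ := by
          refine setIntegral_mono_on (hqF.const_mul _) hBSx measurableSet_Ioi fun y hy => ?_
          have hy0 : 0 ≤ y := hx.trans (le_of_lt hy)
          calc B x * (‖q y‖ * ‖F y‖) ≤ B y * (‖q y‖ * S) := by
                gcongr
                · exact hB0 y hy0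
                · exact hmono (le_of_lt hy)
                · exact hS y hy0
            _ = _ := by ring
  have t2 : ‖∫ y in (0:ℝ)..x, Complex.exp (-(k * (x - y : ℝ))) * expPrimitive k y * (q y * F y)‖ ≤
      ∫ y in (0:ℝ)..x, S * (B y * ‖q y‖) := by
    refine intervalIntegral.norm_integral_le_of_norm_le hx ?_ ?_
    · refine Filter.Eventually.of_forall fun y hy => ?_
      have hy0 : 0 ≤ y := hy.1.le
      simp only [norm_mul]
      calc _ ≤ 1 * B y * (‖q y‖ * S) := by
            gcongr
            · rw [one_mul]
              exact hB0 y hy0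
            · exact norm_cexp_neg_mul_le_one h.re_nonneg (sub_nonneg.2 hy.2)
            · exact hB y hy0
            · exact hS y hy0
        _ = _ := by ring
    · exact (intervalIntegrable_iff_integrableOn_Ioc_of_le hx).2
        (hBS.mono_set Ioc_subset_Ioi_self)
  rw [h.sub_cexp_mul_eq hx]
  calc _ ≤ _ := norm_sub_le _ _
    _ ≤ _ := add_le_add t1 t2
    _ = ∫ y in Ioi (0:ℝ), S * (B y * ‖q y‖) := by
        rw [add_comm, intervalIntegral.integral_interval_add_Ioi hBS hBSx]
    _ = _ := integral_const_mul _ _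

/-- For a small potential the solution is controlled by its value at `0`. -/
theorem norm_le_two_mul (h : IsHalfLineSolution k q F P)
    (hq : ∫ y in Ioi (0:ℝ), y * ‖q y‖ ≤ 1 / 2) {x : ℝ} (hx : 0 ≤ x) : ‖F x‖ ≤ 2 * ‖F 0‖ := by
  obtain ⟨S₀, hS₀⟩ := h.bounded
  have hbdd : BddAbove ((fun y => ‖F y‖) '' Ici (0:ℝ)) :=
    ⟨S₀, by rintro _ ⟨y, -, rfl⟩; exact hS₀ y⟩
  have hne : ((fun y => ‖F y‖) '' Ici (0:ℝ)).Nonempty := ⟨_, 0, self_mem_Ici, rfl⟩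
  -- The supremum is finite by the a priori bound, so `S ≤ ‖F 0‖ + S / 2` can be solved for `S`.
  let S := sSup ((fun y => ‖F y‖) '' Ici (0:ℝ))
  have hS : ∀ y, 0 ≤ y → ‖F y‖ ≤ S := fun y hy => le_csSup hbdd ⟨y, hy, rfl⟩
  have hS0 : 0 ≤ S := (norm_nonneg _).trans (hS 0 le_rfl)
  have hle : S ≤ ‖F 0‖ + S * (1 / 2) := by
    refine csSup_le hne ?_
    rintro _ ⟨y, hy, rfl⟩
    have h1 := h.norm_sub_cexp_mul_le (B := fun y => y)
      (fun y hy => norm_expPrimitive_le h.re_nonneg hy) monotone_id h.integrable_moment hS hy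
    have h2 : ‖Complex.exp (-(k * y)) * F 0‖ ≤ ‖F 0‖ := by
      rw [norm_mul]
      exact mul_le_of_le_one_left (norm_nonneg _) (norm_cexp_neg_mul_le_one h.re_nonneg hy)
    calc ‖F y‖ = ‖(F y - Complex.exp (-(k * y)) * F 0) + Complex.exp (-(k * y)) * F 0‖ := by
          rw [sub_add_cancel]
      _ ≤ S * (1 / 2) + ‖F 0‖ := (norm_add_le _ _).trans
          (add_le_add (h1.trans (by gcongr)) h2)
      _ = _ := add_comm _ _
  have := hS x hx
  linarith

theorem norm_sub_cexp_mul_le_inv (h : IsHalfLineSolution k q F P) (hk : k ≠ 0)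
    (hq : ∫ y in Ioi (0:ℝ), y * ‖q y‖ ≤ 1 / 2) {x : ℝ} (hx : 0 ≤ x) :
    ‖F x - Complex.exp (-(k * x)) * F 0‖ ≤
      2 * ‖F 0‖ * (‖k‖⁻¹ * ∫ y in Ioi (0:ℝ), ‖q y‖) := by
  have := h.norm_sub_cexp_mul_le (B := fun _ => ‖k‖⁻¹)
    (fun y hy => norm_expPrimitive_le_inv h.re_nonneg hk hy) monotone_const
    (h.integrable.norm.const_mul _) (fun y hy => h.norm_le_two_mul hq hy) hx
  rwa [integral_const_mul] at this

/-- `∫_0^∞ e^{-ky} q F` is bounded by the mass of `q`. -/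
theorem norm_integral_le (h : IsHalfLineSolution k q F P)
    (hq : ∫ y in Ioi (0:ℝ), y * ‖q y‖ ≤ 1 / 2) :
    ‖P 0 + k * F 0‖ ≤ 2 * ‖F 0‖ * ∫ y in Ioi (0:ℝ), ‖q y‖ := by
  refine (h.norm_snd_add_le le_rfl).trans ?_
  rw [← integral_const_mul]
  refine setIntegral_mono_on ?_ (h.integrable.norm.const_mul _) measurableSet_Ioi fun y hy => ?_
  · simpa only [norm_mul] using! h.integrableOn_mul.norm
  · rw [mul_comm]
    gcongr
    exact h.norm_le_two_mul hq (le_of_lt hy)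

/-- The first Born approximation of the boundary condition. -/
theorem norm_snd_add_le_inv (h : IsHalfLineSolution k q F P) (hk : k ≠ 0)
    (hq : ∫ y in Ioi (0:ℝ), y * ‖q y‖ ≤ 1 / 2) {L : ℝ}
    (hL : ‖∫ y in Ioi (0:ℝ), Complex.exp (-(2 * k * y)) * q y‖ ≤ L * ‖k‖⁻¹) :
    ‖P 0 + k * F 0‖ ≤ ‖F 0‖ * ‖k‖⁻¹ * (L + 2 * (∫ y in Ioi (0:ℝ), ‖q y‖) ^ 2) := by
  have hre : 0 ≤ (2 * k).re := by simpa using h.re_nonneg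
  have hi : IntegrableOn (fun y : ℝ => Complex.exp (-(2 * k * y)) * q y) (Ioi 0) := by
    refine h.integrable.bdd_mul (c := 1)
      (by fun_prop : Continuous fun x : ℝ => Complex.exp (-(2 * k * x))).aestronglyMeasurable ?_
    exact (ae_restrict_iff' measurableSet_Ioi).2 (Filter.Eventually.of_forall fun x hx =>
      norm_cexp_neg_mul_le_one hre (le_of_lt hx))
  have hexp : ∀ y : ℝ, Complex.exp (-(k * y)) * Complex.exp (-(k * y)) =
      Complex.exp (-(2 * k * y)) := fun y => by
    rw [← Complex.exp_add]
    ring_nf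
  -- `F` is replaced by the free solution `e^{-ky} F(0)`; the remainder is `O(1 / |k|)` by
  -- `norm_sub_cexp_mul_le_inv` and carries a second factor of `q`.
  have hsplit : ∫ y in Ioi (0:ℝ), Complex.exp (-(k * y)) * (q y * F y) =
      F 0 * (∫ y in Ioi (0:ℝ), Complex.exp (-(2 * k * y)) * q y) +
        ∫ y in Ioi (0:ℝ), Complex.exp (-(k * y)) *
          (q y * (F y - Complex.exp (-(k * y)) * F 0)) := by
    rw [← integral_const_mul, ← sub_eq_iff_eq_add', ← integral_sub h.integrableOn_cexp_mul
      (hi.const_mul _)]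
    congr 1
    funext y
    linear_combination q y * F 0 * hexp y
  rw [h.boundary_condition, norm_neg, hsplit]
  have t1 : ‖F 0 * (∫ y in Ioi (0:ℝ), Complex.exp (-(2 * k * y)) * q y)‖ ≤
      ‖F 0‖ * (L * ‖k‖⁻¹) := by
    rw [norm_mul]
    gcongr
  have t2 : ‖∫ y in Ioi (0:ℝ), Complex.exp (-(k * y)) *
      (q y * (F y - Complex.exp (-(k * y)) * F 0))‖ ≤
      ∫ y in Ioi (0:ℝ), 2 * ‖F 0‖ * (‖k‖⁻¹ * ∫ y in Ioi (0:ℝ), ‖q y‖) * ‖q y‖ := by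
    refine norm_integral_le_of_norm_le (h.integrable.norm.const_mul _) ?_
    refine (ae_restrict_iff' measurableSet_Ioi).2 (Filter.Eventually.of_forall fun y hy => ?_)
    have hy' : 0 ≤ y := le_of_lt hy
    rw [norm_mul, norm_mul]
    calc _ ≤ 1 * (‖q y‖ * (2 * ‖F 0‖ * (‖k‖⁻¹ * ∫ y in Ioi (0:ℝ), ‖q y‖))) := by
          gcongr
          · exact norm_cexp_neg_mul_le_one h.re_nonneg hy'
          · exact h.norm_sub_cexp_mul_le_inv hk hq hy'
      _ = _ := by ring
  rw [integral_const_mul] at t2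
  calc _ ≤ _ := norm_add_le _ _
    _ ≤ _ := add_le_add t1 t2
    _ = _ := by ring

end IsHalfLineSolution

/-- Decay of the Laplace transform of a function of class `W^{1,1}`. -/
theorem norm_integral_cexp_mul_le {k : ℂ} (hk : 0 ≤ k.re) (h0 : k ≠ 0) {G g : ℝ → ℂ}
    (hp : ∀ b, 0 ≤ b → PrimitiveOn G g 0 b) (hG : IntegrableOn G (Ioi 0))
    (hg : IntegrableOn g (Ioi 0)) :
    ‖∫ y in Ioi (0:ℝ), Complex.exp (-(2 * k * y)) * G y‖ ≤
      (‖G 0‖ + ∫ y in Ioi (0:ℝ), ‖g y‖) * ‖k‖⁻¹ := by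
  have hre : 0 ≤ (2 * k).re := by simpa using hk
  have hi : ∀ {f : ℝ → ℂ}, IntegrableOn f (Ioi 0) →
      IntegrableOn (fun y : ℝ => Complex.exp (-(2 * k * y)) * f y) (Ioi 0) := fun hf => by
    refine hf.bdd_mul (c := 1)
      (by fun_prop : Continuous fun x : ℝ => Complex.exp (-(2 * k * x))).aestronglyMeasurable ?_
    exact (ae_restrict_iff' measurableSet_Ioi).2 (Filter.Eventually.of_forall fun x hx =>
      norm_cexp_neg_mul_le_one hre (le_of_lt hx))
  have hGx : ∀ x, 0 ≤ x → ‖G x‖ ≤ ‖G 0‖ + ∫ y in Ioi (0:ℝ), ‖g y‖ := fun x hx => by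
    rw [(hp x hx).2 x ⟨hx, le_rfl⟩]
    refine (norm_add_le _ _).trans (add_le_add le_rfl ?_)
    refine (intervalIntegral.norm_integral_le_integral_norm hx).trans ?_
    rw [intervalIntegral.integral_of_le hx]
    exact setIntegral_mono_set hg.norm (Filter.Eventually.of_forall fun _ => norm_nonneg _)
      Ioc_subset_Ioi_self.eventuallyLE
  -- `M` bounds `|G|` on the half-line. Integrating by parts on `[0, x]`, the two boundary terms and
  -- the integral of `g` add up to at most `2 M`; then `x → ∞`.
  set M := ‖G 0‖ + ∫ y in Ioi (0:ℝ), ‖g y‖ with hM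
  have hfin : ∀ x, 0 ≤ x →
      ‖2 * k * ∫ y in (0:ℝ)..x, Complex.exp (-(2 * k * y)) * G y‖ ≤ 2 * M := fun x hx => by
    have i1 := (intervalIntegrable_iff_integrableOn_Ioc_of_le hx).2
      ((hi hG).mono_set Ioc_subset_Ioi_self)
    have i2 := (intervalIntegrable_iff_integrableOn_Ioc_of_le hx).2
      ((hi hg).mono_set Ioc_subset_Ioi_self)
    have h1 := ((hp x hx).mul_left hx (hasDerivAt_cexp_neg_mul (2 * k)) (by fun_prop)).2 x
      ⟨hx, le_rfl⟩
    have i3 : IntervalIntegrable (fun y : ℝ => -(2 * k * (Complex.exp (-(2 * k * y)) * G y)))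
        volume 0 x := (i1.const_mul (2 * k)).neg
    have h2 : ∫ y in (0:ℝ)..x, (-(2 * k * Complex.exp (-(2 * k * y))) * G y +
        Complex.exp (-(2 * k * y)) * g y) =
        -(2 * k * ∫ y in (0:ℝ)..x, Complex.exp (-(2 * k * y)) * G y) +
          ∫ y in (0:ℝ)..x, Complex.exp (-(2 * k * y)) * g y := by
      rw [← intervalIntegral.integral_const_mul, ← intervalIntegral.integral_neg,
        ← intervalIntegral.integral_add i3 i2]
      congr 1
      funext y
      ring
    rw [h2] at h1
    simp only [Complex.ofReal_zero, mul_zero, neg_zero, Complex.exp_zero, one_mul] at h1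
    have h3 : 2 * k * ∫ y in (0:ℝ)..x, Complex.exp (-(2 * k * y)) * G y =
        G 0 + (∫ y in (0:ℝ)..x, Complex.exp (-(2 * k * y)) * g y) -
          Complex.exp (-(2 * k * x)) * G x := by
      linear_combination h1
    have h4 : ‖∫ y in (0:ℝ)..x, Complex.exp (-(2 * k * y)) * g y‖ ≤
        ∫ y in Ioi (0:ℝ), ‖g y‖ := by
      rw [intervalIntegral.integral_of_le hx]
      refine (norm_integral_le_of_norm_le (hg.mono_set Ioc_subset_Ioi_self).norm ?_).trans
        (setIntegral_mono_set hg.norm (Filter.Eventually.of_forall fun _ => norm_nonneg _)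
          Ioc_subset_Ioi_self.eventuallyLE)
      refine (ae_restrict_iff' measurableSet_Ioc).2 (Filter.Eventually.of_forall fun y hy => ?_)
      rw [norm_mul]
      exact mul_le_of_le_one_left (norm_nonneg _) (norm_cexp_neg_mul_le_one hre hy.1.le)
    have h5 : ‖Complex.exp (-(2 * k * x)) * G x‖ ≤ M := by
      rw [norm_mul]
      exact (mul_le_of_le_one_left (norm_nonneg _) (norm_cexp_neg_mul_le_one hre hx)).trans
        (hGx x hx)
    rw [h3]
    calc _ ≤ _ := norm_sub_le _ _
      _ ≤ ‖G 0‖ + (∫ y in Ioi (0:ℝ), ‖g y‖) + M :=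
          add_le_add ((norm_add_le _ _).trans (add_le_add le_rfl h4)) h5
      _ = 2 * M := by rw [← hM]; ring
  have hlim := ((intervalIntegral_tendsto_integral_Ioi 0 (hi hG)
    Filter.tendsto_id).const_mul (2 * k)).norm
  have hle := le_of_tendsto hlim ((Filter.eventually_ge_atTop 0).mono hfin)
  rw [norm_mul, norm_mul, RCLike.norm_ofNat] at hle
  rw [← div_eq_mul_inv, le_div_iff₀ (norm_pos_iff.2 h0)]
  linarith

/-! ### Matching of the two half-lines -/

/-- The constant in the bound for the boundary values of half-line solutions with
potential `ε w`, where `w'` is the derivative of `w`. -/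
noncomputable def bornBound (w w' : ℝ → ℂ) : ℝ :=
  2 * (∫ y in Ioi (0:ℝ), ‖w y‖) + (‖w 0‖ + ∫ y in Ioi (0:ℝ), ‖w' y‖) +
    2 * (∫ y in Ioi (0:ℝ), ‖w y‖) ^ 2

theorem bornBound_nonneg (w w' : ℝ → ℂ) : 0 ≤ bornBound w w' := by
  have h1 : 0 ≤ ∫ y in Ioi (0:ℝ), ‖w y‖ := integral_nonneg fun _ => norm_nonneg _
  have h2 : 0 ≤ ∫ y in Ioi (0:ℝ), ‖w' y‖ := integral_nonneg fun _ => norm_nonneg _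
  unfold bornBound
  positivity

namespace IsHalfLineSolution

variable {k : ℂ} {w w' F P : ℝ → ℂ} {ε : ℝ}

theorem moment_le (hε : 0 ≤ ε) (hsmall : ε * ∫ y in Ioi (0:ℝ), y * ‖w y‖ ≤ 1 / 2) :
    ∫ y in Ioi (0:ℝ), y * ‖(ε : ℂ) * w y‖ ≤ 1 / 2 := by
  refine le_trans (le_of_eq ?_) hsmall
  rw [← integral_const_mul]
  congr 1
  funext y
  rw [norm_mul, Complex.norm_real, Real.norm_of_nonneg hε]
  ring

/-- The first summand of `bornBound` accounts for the bound uniform in `k`, the other two for the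
bound with the factor `‖k‖`; there the second-order term `ε²` is absorbed using `ε ≤ 1`. -/
theorem boundary_bound (h : IsHalfLineSolution k (fun x => (ε : ℂ) * w x) F P) (hε : 0 ≤ ε)
    (hε1 : ε ≤ 1) (hsmall : ε * ∫ y in Ioi (0:ℝ), y * ‖w y‖ ≤ 1 / 2)
    (hp : ∀ b, 0 ≤ b → PrimitiveOn w w' 0 b) (hw : IntegrableOn w (Ioi 0))
    (hw' : IntegrableOn w' (Ioi 0)) :
    ‖P 0 + k * F 0‖ ≤ ε * bornBound w w' * ‖F 0‖ ∧
      ‖k‖ * ‖P 0 + k * F 0‖ ≤ ε * bornBound w w' * ‖F 0‖ := by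
  have hq := moment_le hε hsmall
  have hmass : ∫ y in Ioi (0:ℝ), ‖(ε : ℂ) * w y‖ = ε * ∫ y in Ioi (0:ℝ), ‖w y‖ := by
    rw [← integral_const_mul]
    simp only [norm_mul, Complex.norm_real, Real.norm_of_nonneg hε]
  have hB := bornBound_nonneg w w'
  have hM : 0 ≤ ∫ y in Ioi (0:ℝ), ‖w y‖ := integral_nonneg fun _ => norm_nonneg _
  have hM' : 0 ≤ ∫ y in Ioi (0:ℝ), ‖w' y‖ := integral_nonneg fun _ => norm_nonneg _
  have hF := norm_nonneg (F 0)
  constructor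
  · refine (h.norm_integral_le hq).trans ?_
    rw [hmass]
    calc _ = ε * (2 * ∫ y in Ioi (0:ℝ), ‖w y‖) * ‖F 0‖ := by ring
      _ ≤ _ := by
        gcongr
        unfold bornBound
        have := norm_nonneg (w 0)
        have := sq_nonneg (∫ y in Ioi (0:ℝ), ‖w y‖)
        linarith
  · rcases eq_or_ne k 0 with rfl | hk
    · rw [norm_zero, zero_mul]
      positivity
    · have hkn := norm_pos_iff.2 hk
      have hL : ‖∫ y in Ioi (0:ℝ), Complex.exp (-(2 * k * y)) * ((ε : ℂ) * w y)‖ ≤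
          ε * (‖w 0‖ + ∫ y in Ioi (0:ℝ), ‖w' y‖) * ‖k‖⁻¹ := by
        have e : ∫ y in Ioi (0:ℝ), Complex.exp (-(2 * k * y)) * ((ε : ℂ) * w y) =
            (ε : ℂ) * ∫ y in Ioi (0:ℝ), Complex.exp (-(2 * k * y)) * w y := by
          rw [← integral_const_mul]
          congr 1
          funext y
          ring
        rw [e, norm_mul, Complex.norm_real, Real.norm_of_nonneg hε, mul_assoc]
        gcongr
        exact norm_integral_cexp_mul_le h.re_nonneg hk hp hw hw'
      have h1 := h.norm_snd_add_le_inv hk hq hL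
      rw [hmass] at h1
      calc _ ≤ ‖k‖ * _ := mul_le_mul_of_nonneg_left h1 hkn.le
        _ = ‖F 0‖ * (ε * (‖w 0‖ + ∫ y in Ioi (0:ℝ), ‖w' y‖) +
            2 * (ε * ∫ y in Ioi (0:ℝ), ‖w y‖) ^ 2) := by
          field_simp
        _ ≤ ‖F 0‖ * (ε * bornBound w w') := by
          gcongr
          unfold bornBound
          have h2 : ε * ε ≤ ε * 1 := mul_le_mul_of_nonneg_left hε1 hε
          have h3 := mul_le_mul_of_nonneg_right h2 (sq_nonneg (∫ y in Ioi (0:ℝ), ‖w y‖))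
          have h4 := mul_nonneg hε hM
          nlinarith
        _ = _ := by ring

/-- Two half-line solutions with opposite initial slopes and small potentials vanish at `0`. -/
theorem eq_zero_of_matching {k₁ k₂ : ℂ} {w₁ w₁' w₂ w₂' F₁ P₁ F₂ P₂ : ℝ → ℂ}
    (h₁ : IsHalfLineSolution k₁ (fun x => (ε : ℂ) * w₁ x) F₁ P₁)
    (h₂ : IsHalfLineSolution k₂ (fun x => (ε : ℂ) * w₂ x) F₂ P₂)
    (hF : F₂ 0 = F₁ 0) (hP : P₂ 0 = -P₁ 0) {z : ℂ}
    (hk₁ : k₁ ^ 2 = Complex.I - z) (hk₂ : k₂ ^ 2 = -Complex.I - z)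
    (hε : 0 ≤ ε) (hε1 : ε ≤ 1)
    (hs₁ : ε * ∫ y in Ioi (0:ℝ), y * ‖w₁ y‖ ≤ 1 / 2)
    (hs₂ : ε * ∫ y in Ioi (0:ℝ), y * ‖w₂ y‖ ≤ 1 / 2)
    (hB : ε * (bornBound w₁ w₁' + bornBound w₂ w₂') < 1 / 2)
    (hp₁ : ∀ b, 0 ≤ b → PrimitiveOn w₁ w₁' 0 b) (hp₂ : ∀ b, 0 ≤ b → PrimitiveOn w₂ w₂' 0 b)
    (hw₁ : IntegrableOn w₁ (Ioi 0)) (hw₂ : IntegrableOn w₂ (Ioi 0))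
    (hw₁' : IntegrableOn w₁' (Ioi 0)) (hw₂' : IntegrableOn w₂' (Ioi 0)) : F₁ 0 = 0 := by
  obtain ⟨a1, a2⟩ := h₁.boundary_bound hε hε1 hs₁ hp₁ hw₁ hw₁'
  obtain ⟨b1, b2⟩ := h₂.boundary_bound hε hε1 hs₂ hp₂ hw₂ hw₂'
  rw [hF] at b1 b2
  set X := P₁ 0 + k₁ * F₁ 0 with hX
  set Y := P₂ 0 + k₂ * F₁ 0 with hY
  -- The slopes cancel in `X + Y = (k₁ + k₂) F(0)`, and `k₁² - k₂² = 2i` does not depend on `z`.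
  have key : (k₁ - k₂) * (X + Y) = 2 * Complex.I * F₁ 0 := by
    rw [hX, hY, hP]
    linear_combination F₁ 0 * (hk₁ - hk₂)
  have hn : 2 * ‖F₁ 0‖ = ‖k₁ - k₂‖ * ‖X + Y‖ := by
    rw [← norm_mul, key]
    simp
  -- Needed for the mixed products: `Y` is controlled with the weight `‖k₂‖` only, and `X` with
  -- `‖k₁‖` only.
  have d1 : ‖k₁‖ ≤ ‖k₂‖ + 2 := by
    have h1 : ‖k₁‖ ^ 2 ≤ ‖k₂‖ ^ 2 + 2 := by
      rw [← norm_pow, ← norm_pow, hk₁, hk₂]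
      calc ‖Complex.I - z‖ = ‖(-Complex.I - z) + 2 * Complex.I‖ := by ring_nf
        _ ≤ _ := (norm_add_le _ _).trans (by simp)
    nlinarith [norm_nonneg k₁, norm_nonneg k₂]
  have d2 : ‖k₂‖ ≤ ‖k₁‖ + 2 := by
    have h1 : ‖k₂‖ ^ 2 ≤ ‖k₁‖ ^ 2 + 2 := by
      rw [← norm_pow, ← norm_pow, hk₁, hk₂]
      calc ‖-Complex.I - z‖ = ‖(Complex.I - z) - 2 * Complex.I‖ := by ring_nf
        _ ≤ _ := (norm_sub_le _ _).trans (by simp)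
    nlinarith [norm_nonneg k₁, norm_nonneg k₂]
  have hle : 2 * ‖F₁ 0‖ ≤ (‖k₁‖ + ‖k₂‖) * (‖X‖ + ‖Y‖) := by
    rw [hn]
    gcongr
    · exact norm_sub_le _ _
    · exact norm_add_le _ _
  have e1 : ‖k₁‖ * ‖Y‖ ≤ (‖k₂‖ + 2) * ‖Y‖ := mul_le_mul_of_nonneg_right d1 (norm_nonneg _)
  have e2 : ‖k₂‖ * ‖X‖ ≤ (‖k₁‖ + 2) * ‖X‖ := mul_le_mul_of_nonneg_right d2 (norm_nonneg _)
  -- Each of `X`, `Y` contributes `(2 ‖k‖ + 2)` times its norm with its own `k`, hence the `4`; the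
  -- threshold `1 / 2` in `hB` then makes the factor smaller than `2`.
  have hfin : 2 * ‖F₁ 0‖ ≤ 4 * (ε * (bornBound w₁ w₁' + bornBound w₂ w₂')) * ‖F₁ 0‖ := by
    nlinarith
  by_contra hne
  have hpos := norm_pos_iff.2 hne
  nlinarith

end IsHalfLineSolution

/-! ### From eigenfunctions to bounded solutions of the differential equation -/

theorem exists_sq_eq_re_nonneg (c : ℂ) : ∃ k : ℂ, k ^ 2 = c ∧ 0 ≤ k.re := by
  obtain ⟨k, hk⟩ := IsAlgClosed.exists_pow_nat_eq c (n := 2) (by norm_num)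
  rcases le_total 0 k.re with h | h
  · exact ⟨k, hk, h⟩
  · exact ⟨-k, by rw [neg_sq, hk], by simpa using h⟩

/-- Functions of `W^{1,2}` are bounded. -/
theorem exists_bound_of_primitive {F P : ℝ → ℂ} (hF : Continuous F) (hP : Continuous P)
    (hp : ∀ a b, a ≤ b → PrimitiveOn F P a b) (hF2 : MemLp F 2) (hP2 : MemLp P 2) :
    ∃ S, ∀ x, ‖F x‖ ≤ S := by
  have iF := (memLp_two_iff_integrable_sq_norm hF.aestronglyMeasurable).1 hF2
  have iP := (memLp_two_iff_integrable_sq_norm hP.aestronglyMeasurable).1 hP2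
  -- Average `|F(x)| ≤ |F(y)| + ∫ |P|` over `y ∈ [x, x + 1]` and use `|f| ≤ 1 + |f|²` once for `F`
  -- and once for `P`.
  refine ⟨2 + (∫ x, ‖F x‖ ^ 2) + ∫ x, ‖P x‖ ^ 2, fun x => ?_⟩
  have hloc : ∀ {f : ℝ → ℂ}, Continuous f → Integrable (fun x => ‖f x‖ ^ 2) →
      ∀ a, ∫ y in a..a + 1, ‖f y‖ ≤ 1 + ∫ y, ‖f y‖ ^ 2 := fun {f} hf hi a => by
    have ha : a ≤ a + 1 := by linarith
    calc ∫ y in a..a + 1, ‖f y‖ ≤ ∫ y in a..a + 1, (1 + ‖f y‖ ^ 2) := by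
          refine intervalIntegral.integral_mono_on ha (hf.norm.intervalIntegrable _ _)
            ((by fun_prop : Continuous fun y => 1 + ‖f y‖ ^ 2).intervalIntegrable _ _)
            fun y _ => ?_
          nlinarith [sq_nonneg (‖f y‖ - 1), sq_nonneg ‖f y‖]
      _ = 1 + ∫ y in a..a + 1, ‖f y‖ ^ 2 := by
          rw [intervalIntegral.integral_add intervalIntegrable_const
            ((by fun_prop : Continuous fun y => ‖f y‖ ^ 2).intervalIntegrable _ _)]
          simp
      _ ≤ _ := by
          gcongr
          rw [intervalIntegral.integral_of_le ha]
          exact setIntegral_le_integral hi (Filter.Eventually.of_forall fun _ => by positivity)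
  have hx : x ≤ x + 1 := by linarith
  have hpt : ∀ y ∈ Icc x (x + 1), ‖F x‖ ≤ ‖F y‖ + ∫ t in x..x + 1, ‖P t‖ := fun y hy => by
    have e := (hp x (x + 1) hx).2 y hy
    have h1 : ‖∫ t in x..y, P t‖ ≤ ∫ t in x..x + 1, ‖P t‖ := by
      refine (intervalIntegral.norm_integral_le_integral_norm hy.1).trans ?_
      rw [intervalIntegral.integral_of_le hy.1, intervalIntegral.integral_of_le hx]
      exact setIntegral_mono_set (hP.norm.integrableOn_Ioc)
        (Filter.Eventually.of_forall fun _ => norm_nonneg _)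
        (Ioc_subset_Ioc_right hy.2).eventuallyLE
    calc ‖F x‖ = ‖F y - ∫ t in x..y, P t‖ := by rw [e, add_sub_cancel_right]
      _ ≤ _ := (norm_sub_le _ _).trans (add_le_add le_rfl h1)
  have hint := intervalIntegral.integral_mono_on hx
    (intervalIntegrable_const : IntervalIntegrable (fun _ => ‖F x‖) volume x (x + 1))
    ((hF.norm.intervalIntegrable x (x + 1)).add intervalIntegrable_const) hpt
  rw [intervalIntegral.integral_add (hF.norm.intervalIntegrable _ _) intervalIntegrable_const]
    at hint
  simp only [intervalIntegral.integral_const, add_sub_cancel_left, one_smul] at hint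
  linarith [hloc hF iF x, hloc hP iP x]

/-- `i sgn(x)`, up to the value at `0`. -/
noncomputable def signPotential (x : ℝ) : ℂ := if 0 < x then Complex.I else -Complex.I

theorem measurable_signPotential : Measurable signPotential :=
  Measurable.ite measurableSet_Ioi measurable_const measurable_const

theorem norm_signPotential (x : ℝ) : ‖signPotential x‖ = 1 := by
  unfold signPotential
  split_ifs <;> simp

/-- `|V ψ|` is the product of the square-integrable functions `|V|^{1/2}` and `|V|^{1/2} |ψ|`. -/
theorem integrable_mul_of_mem_formDomain (V : Lp ℂ 1 (volume : Measure ℝ)) {ψ : L2R}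
    (hψ : ψ ∈ formDomain V) : Integrable (fun x => V x * ψ x) := by
  have hV : Integrable V (volume : Measure ℝ) := memLp_one_iff_integrable.1 (Lp.memLp V)
  have hm : AEStronglyMeasurable (fun x => (Real.sqrt ‖V x‖ : ℂ)) (volume : Measure ℝ) :=
    (Complex.continuous_ofReal.comp Real.continuous_sqrt).comp_aestronglyMeasurable
      hV.aestronglyMeasurable.norm
  have hs : MemLp (fun x => (Real.sqrt ‖V x‖ : ℂ)) 2 (volume : Measure ℝ) := by
    rw [memLp_two_iff_integrable_sq_norm hm]
    refine hV.norm.congr (Filter.Eventually.of_forall fun x => ?_)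
    simp [abs_of_nonneg (Real.sqrt_nonneg _)]
  refine (MemLp.integrable_mul hs hψ.2).mono
    (hV.aestronglyMeasurable.mul (Lp.aestronglyMeasurable ψ)) ?_
  refine Filter.Eventually.of_forall fun x => le_of_eq ?_
  simp only [Pi.mul_apply, norm_mul, Complex.norm_real, Real.norm_eq_abs,
    abs_of_nonneg (Real.sqrt_nonneg _)]
  linear_combination (-‖ψ x‖) * Real.mul_self_sqrt (norm_nonneg (V x))

/-- The eigenvalue equation in the sense of distributions. -/
theorem hasWeakDeriv_weakDeriv_of_mem_perturbedGraph (V : Lp ℂ 1 (volume : Measure ℝ)) {ε : ℝ}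
    {ψ : L2R} {z : ℂ} (h : (ψ, z • ψ) ∈ perturbedGraph V ε) :
    HasWeakDeriv (weakDeriv ψ)
      (fun x => (signPotential x - z) * ψ x + (ε : ℂ) * (V x * ψ x)) := by
  obtain ⟨hψ, hform⟩ := h
  obtain ⟨hw, -⟩ := hψ.1.memLp_weakDeriv
  have hVψ := integrable_mul_of_mem_formDomain V hψ
  have hψl : LocallyIntegrable ψ := hw.1
  have hsl : LocallyIntegrable (fun x => signPotential x * ψ x) := by
    refine MemLp.locallyIntegrable (p := 2) ((Lp.memLp ψ).of_le
      (measurable_signPotential.aestronglyMeasurable.mul (Lp.aestronglyMeasurable ψ)) ?_)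
      one_le_two
    exact Filter.Eventually.of_forall fun x => by simp [norm_signPotential]
  have hzl : LocallyIntegrable (fun x => z * ψ x) := hψl.smul z
  have hVl : LocallyIntegrable (fun x => (ε : ℂ) * (V x * ψ x)) :=
    (hVψ.const_mul (ε : ℂ)).locallyIntegrable
  refine ⟨hw.2.1, ?_, fun φ hφ hc => ?_⟩
  · have := (hsl.sub hzl).add hVl
    refine this.congr (Filter.Eventually.of_forall fun x => ?_)
    simp only [Pi.add_apply, Pi.sub_apply]
    ring
  · have hL : MemLp (fun x => (φ x : ℂ)) 2 (volume : Measure ℝ) :=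
      (Complex.continuous_ofReal.comp hφ.continuous).memLp_of_hasCompactSupport
        (hc.comp_left Complex.ofReal_zero)
    -- The form is tested against a real test function, so the conjugations disappear.
    have key := hform _ (toLp_mem_formDomain V hφ hc hL)
    have hco := hL.coeFn_toLp
    have hwd : weakDeriv (hL.toLp _) =ᵐ[volume] fun x => ((deriv φ x : ℝ) : ℂ) :=
      ((hasWeakDeriv_of_contDiff φ hφ).congr hco.symm).weakDeriv_ae_eq
    have e1 : ∫ x, weakDeriv ψ x * conj (weakDeriv (hL.toLp _) x) =
        ∫ x, deriv φ x • weakDeriv ψ x := by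
      refine integral_congr_ae ?_
      filter_upwards [hwd] with x hx
      simp [hx, mul_comm]
    have e2 : ∀ s : Set ℝ, ∫ x in s, ψ x * conj (hL.toLp _ x) = ∫ x in s, φ x • ψ x :=
      fun s => by
        refine integral_congr_ae (ae_restrict_of_ae ?_)
        filter_upwards [hco] with x hx
        simp [hx, mul_comm]
    have e3 : ∫ x, V x * ψ x * conj (hL.toLp _ x) = ∫ x, φ x • (V x * ψ x) := by
      refine integral_congr_ae ?_
      filter_upwards [hco] with x hx
      simp [hx, mul_comm]
    have e4 : inner ℂ (hL.toLp _) (z • ψ) = ∫ x, φ x • (z * ψ x) := by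
      rw [L2.inner_def]
      refine integral_congr_ae ?_
      filter_upwards [hco, Lp.coeFn_smul z ψ] with x hx hx'
      simp [hx, hx', mul_comm]
    have is := hsl.integrable_smul_left_of_hasCompactSupport hφ.continuous hc
    have iz := hzl.integrable_smul_left_of_hasCompactSupport hφ.continuous hc
    have iV := hVl.integrable_smul_left_of_hasCompactSupport hφ.continuous hc
    have e5 : ∫ x, φ x • (signPotential x * ψ x) =
        Complex.I * (∫ x in Ioi 0, φ x • ψ x) - Complex.I * ∫ x in Iio 0, φ x • ψ x := by
      rw [← intervalIntegral.integral_Iic_add_Ioi (b := 0) is.integrableOn is.integrableOn,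
        ← integral_Iic_eq_integral_Iio, ← integral_const_mul, ← integral_const_mul]
      have f1 : ∫ x in Iic (0:ℝ), φ x • (signPotential x * ψ x) =
          -∫ x in Iic (0:ℝ), Complex.I * φ x • ψ x := by
        rw [← integral_neg]
        refine setIntegral_congr_fun measurableSet_Iic fun x hx => ?_
        simp only [signPotential, if_neg (not_lt.2 (mem_Iic.1 hx)), Complex.real_smul]
        ring
      have f2 : ∫ x in Ioi (0:ℝ), φ x • (signPotential x * ψ x) =
          ∫ x in Ioi (0:ℝ), Complex.I * φ x • ψ x := by
        refine setIntegral_congr_fun measurableSet_Ioi fun x hx => ?_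
        simp only [signPotential, if_pos (mem_Ioi.1 hx), Complex.real_smul]
        ring
      rw [f1, f2]
      ring
    have e6 : ∫ x, φ x • ((signPotential x - z) * ψ x + (ε : ℂ) * (V x * ψ x)) =
        (∫ x, φ x • (signPotential x * ψ x)) - (∫ x, φ x • (z * ψ x)) +
          ε * ∫ x, φ x • (V x * ψ x) := by
      have e7 : ε * ∫ x, φ x • (V x * ψ x) = ∫ x, φ x • ((ε : ℂ) * (V x * ψ x)) := by
        rw [← integral_const_mul]
        congr 1
        funext x
        simp only [Complex.real_smul]
        ring
      have isz : Integrable (fun x => φ x • (signPotential x * ψ x) - φ x • (z * ψ x)) := is.sub iz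
      rw [e7, ← integral_sub is iz, ← integral_add isz iV]
      congr 1
      funext x
      simp only [Complex.real_smul]
      ring
    simp only [perturbedForm, e1, e2, e3, e4] at key
    rw [e6, e5]
    linear_combination key

/-- Every eigenfunction has a `C¹` representative solving the differential equation. -/
theorem exists_solution_of_mem_pointSpectrum (V : Lp ℂ 1 (volume : Measure ℝ)) {ε : ℝ} {z : ℂ}
    (hz : z ∈ pointSpectrum (perturbedOperator V ε)) :
    ∃ F P : ℝ → ℂ, Continuous F ∧ Continuous P ∧ MemLp F 2 ∧ MemLp P 2 ∧ F ≠ 0 ∧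
      (∀ a b, a ≤ b → PrimitiveOn F P a b) ∧
      ∀ a b, a ≤ b →
        PrimitiveOn P (fun x => (signPotential x - z) * F x + (ε : ℂ) * (V x * F x)) a b := by
  obtain ⟨ψ, hne, hev⟩ := hz
  have hmem : ((ψ : L2R), z • (ψ : L2R)) ∈ perturbedGraph V ε := by
    rw [← perturbedOperator_graph, LinearPMap.mem_graph_iff]
    exact ⟨ψ, rfl, hev⟩
  obtain ⟨hw, hw2⟩ := hmem.1.1.memLp_weakDeriv
  obtain ⟨F, hF, hFc, hFp⟩ := hw.exists_primitive
  obtain ⟨P, hP, hPc, hPp⟩ := (hasWeakDeriv_weakDeriv_of_mem_perturbedGraph V hmem).exists_primitive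
  refine ⟨F, P, hFc, hPc, (Lp.memLp _).ae_eq hF, hw2.ae_eq hP, ?_, fun a b hab => ?_,
    fun a b hab => ?_⟩
  · rintro rfl
    exact hne ((Lp.eq_zero_iff_ae_eq_zero).2 hF)
  · exact (hFp a b hab).congr_ae hab (hP.mono fun x hx _ => hx)
  · exact (hPp a b hab).congr_ae hab (hF.mono fun x hx _ => by rw [hx])

/-! ### Absence of eigenvalues at small coupling -/

/-- For a weighted `W^{1,1}` potential and small coupling the operator has no eigenvalues. -/
theorem exists_pointSpectrum_eq_empty (V : Lp ℂ 1 (volume : Measure ℝ))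
    (hmom : Integrable (fun x => x * ‖V x‖)) (hV : MemW1 1 V) :
    ∃ ε₀ : ℝ, 0 < ε₀ ∧ ∀ ε : ℝ, 0 < ε → ε < ε₀ → pointSpectrum (perturbedOperator V ε) = ∅ := by
  obtain ⟨hV1, g, hg, hg1⟩ := hV
  -- The absolutely continuous representative is needed because the value of the potential at `0`
  -- enters `bornBound`.
  obtain ⟨W, hVW, hWc, hWp⟩ := hg.exists_primitive
  have hgi : Integrable g := memLp_one_iff_integrable.1 hg1
  have hWi : Integrable W := (memLp_one_iff_integrable.1 hV1).congr hVW
  have hWm : Integrable (fun x => x * ‖W x‖) := hmom.congr (hVW.mono fun x hx => by simp only [hx])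
  have hWm' : Integrable (fun x => x * ‖W (-x)‖) := by
    simpa using hWm.comp_neg.neg
  let w₂ : ℝ → ℂ := fun x => W (-x)
  let w₂' : ℝ → ℂ := fun x => -g (-x)
  have hp₂ : ∀ b, 0 ≤ b → PrimitiveOn w₂ w₂' 0 b := fun b hb =>
    PrimitiveOn.comp_neg (hWp _ _ (by simpa using hb))
  set M := (∫ y in Ioi (0:ℝ), y * ‖W y‖) + ∫ y in Ioi (0:ℝ), y * ‖w₂ y‖ with hM
  set K := bornBound W g + bornBound w₂ w₂' with hK
  have hM₁ : 0 ≤ ∫ y in Ioi (0:ℝ), y * ‖W y‖ := setIntegral_nonneg measurableSet_Ioi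
    fun y hy => mul_nonneg (le_of_lt hy) (norm_nonneg _)
  have hM₂ : 0 ≤ ∫ y in Ioi (0:ℝ), y * ‖w₂ y‖ := setIntegral_nonneg measurableSet_Ioi
    fun y hy => mul_nonneg (le_of_lt hy) (norm_nonneg _)
  have hK₁ := bornBound_nonneg W g
  have hK₂ := bornBound_nonneg w₂ w₂'
  have hD : 0 < 2 * (1 + M + K) := by positivity
  -- The moments in `M` and the constants in `K` are nonnegative, so below this threshold `ε (1 + M
  -- + K) < 1 / 2`, which yields every smallness condition at once, including `ε ≤ 1`.
  refine ⟨1 / (2 * (1 + M + K)), by positivity, fun ε hε hlt => ?_⟩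
  rw [lt_div_iff₀ hD] at hlt
  have hεM₁ := mul_nonneg hε.le hM₁
  have hεM₂ := mul_nonneg hε.le hM₂
  have hεK₁ := mul_nonneg hε.le hK₁
  have hεK₂ := mul_nonneg hε.le hK₂
  have hexp : ε * (∫ y in Ioi (0:ℝ), y * ‖W y‖) + ε * (∫ y in Ioi (0:ℝ), y * ‖w₂ y‖) +
      ε * bornBound W g + ε * bornBound w₂ w₂' + ε < 1 / 2 := by
    rw [hM, hK] at hlt
    linarith
  refine eq_empty_of_forall_notMem fun z hz => ?_
  obtain ⟨F, P, hFc, hPc, hF2, hP2, hne, hFp, hPp⟩ := exists_solution_of_mem_pointSpectrum V hz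
  obtain ⟨S, hS⟩ := exists_bound_of_primitive hFc hPc hFp hF2 hP2
  obtain ⟨k₁, hk₁, hre₁⟩ := exists_sq_eq_re_nonneg (Complex.I - z)
  obtain ⟨k₂, hk₂, hre₂⟩ := exists_sq_eq_re_nonneg (-Complex.I - z)
  have hq : ∀ {w : ℝ → ℂ}, Integrable (fun x => x * ‖w x‖) →
      IntegrableOn (fun x => x * ‖(ε : ℂ) * w x‖) (Ioi 0) := fun hw => by
    refine ((hw.const_mul ε).congr (Filter.Eventually.of_forall fun x => ?_)).integrableOn
    simp only [norm_mul, Complex.norm_real, Real.norm_of_nonneg hε.le]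
    ring
  have h₁ : IsHalfLineSolution k₁ (fun x => (ε : ℂ) * W x) F P :=
    { re_nonneg := hre₁
      continuous_fst := hFc
      continuous_snd := hPc
      bounded := ⟨S, hS⟩
      primitive_fst := fun b hb => hFp 0 b hb
      primitive_snd := fun b hb => (hPp 0 b hb).congr_ae hb (hVW.mono fun x hx hxb => by
        rw [hx, hk₁, signPotential, if_pos hxb.1]
        ring)
      memLp_fst := hF2.restrict _
      memLp_snd := hP2.restrict _
      integrable := (hWi.const_mul _).integrableOn
      integrable_moment := hq hWm }
  have hneg : MeasurePreserving (fun x : ℝ => -x) volume volume := Measure.measurePreserving_neg _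
  have h₂ : IsHalfLineSolution k₂ (fun x => (ε : ℂ) * w₂ x) (fun x => F (-x)) (fun x => -P (-x)) :=
    { re_nonneg := hre₂
      continuous_fst := hFc.comp continuous_neg
      continuous_snd := (hPc.comp continuous_neg).neg
      bounded := ⟨S, fun x => hS _⟩
      primitive_fst := fun b hb => PrimitiveOn.comp_neg (hFp _ _ (by simpa using hb))
      primitive_snd := fun b hb => by
        have hb' : -b ≤ -0 := by simpa using hb
        have hae : ∀ᵐ x, x ∈ Ioc (-b) (-0) →
            (signPotential x - z) * F x + (ε : ℂ) * (V x * F x) =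
              k₂ ^ 2 * F x + (ε : ℂ) * W x * F x := hVW.mono fun x hx hxb => by
          have : ¬ 0 < x := not_lt.2 (by simpa using hxb.2)
          rw [hx, hk₂, signPotential, if_neg this]
          ring
        have h1 := PrimitiveOn.comp_neg ((hPp _ _ hb').congr_ae hb' hae)
        -- Reflection changes the sign of the derivative, and the slope of the reflected solution is
        -- `-P (-x)`; multiplying by `-1` reconciles the two.
        have h2 := h1.mul_left hb (u := fun _ => -1) (u' := fun _ => 0)
          (fun x => hasDerivAt_const x _) continuous_const
        simpa [w₂] using h2
      memLp_fst := (hF2.comp_measurePreserving hneg).restrict _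
      memLp_snd := (hP2.comp_measurePreserving hneg).neg.restrict _
      integrable := (hWi.comp_neg.const_mul _).integrableOn
      integrable_moment := hq hWm' }
  have hs₁ : ε * ∫ y in Ioi (0:ℝ), y * ‖W y‖ ≤ 1 / 2 := by linarith
  have hs₂ : ε * ∫ y in Ioi (0:ℝ), y * ‖w₂ y‖ ≤ 1 / 2 := by linarith
  have h0 : F 0 = 0 := IsHalfLineSolution.eq_zero_of_matching h₁ h₂ (by simp) (by simp) hk₁ hk₂
    hε.le (by linarith) hs₁ hs₂ (by rw [mul_add]; linarith) (fun b hb => hWp 0 b hb) hp₂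
    hWi.integrableOn hWi.comp_neg.integrableOn hgi.integrableOn hgi.comp_neg.neg.integrableOn
  -- Both half-line solutions are dominated by twice their common value at `0`, which is zero.
  refine hne (funext fun x => ?_)
  rw [Pi.zero_apply, ← norm_le_zero_iff]
  rcases le_total 0 x with hx | hx
  · simpa [h0] using h₁.norm_le_two_mul (IsHalfLineSolution.moment_le hε.le hs₁) hx
  · simpa [h0] using h₂.norm_le_two_mul (IsHalfLineSolution.moment_le hε.le hs₂)
      (neg_nonneg.2 hx)

/-! ### Moment and Sobolev conditions for the two classes of potentials -/

theorem integrable_moment_of_integrable_weight {V : Lp ℂ 1 (volume : Measure ℝ)} {n : ℕ}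
    (hn : n ≠ 0) (h : Integrable (fun x : ℝ => ((1 + x ^ (2 * n) : ℝ) : ℂ) * V x)) :
    Integrable (fun x => x * ‖V x‖) := by
  refine h.mono (aestronglyMeasurable_id.mul (Lp.aestronglyMeasurable V).norm)
    (Filter.Eventually.of_forall fun x => ?_)
  rw [norm_mul, norm_mul, norm_norm, Complex.norm_real]
  refine mul_le_mul_of_nonneg_right ?_ (norm_nonneg _)
  have he : x ^ (2 * n) = |x| ^ (2 * n) := by
    rw [pow_mul, pow_mul, sq_abs]
  have h0 : 0 ≤ |x| ^ (2 * n) := by positivity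
  rw [he, Real.norm_of_nonneg (by positivity : 0 ≤ 1 + |x| ^ (2 * n)), Real.norm_eq_abs]
  rcases le_total |x| 1 with hx | hx
  · linarith
  · linarith [le_self_pow₀ hx (by omega : 2 * n ≠ 0)]

theorem SchwartzMap.hasWeakDeriv (f : 𝓢(ℝ, ℂ)) : HasWeakDeriv f (deriv f) := by
  have hd : ∀ x, HasDerivAt f (deriv f x) x := fun x => f.differentiableAt.hasDerivAt
  have hdc : Continuous (deriv f) := (f.smooth 1).continuous_deriv le_rfl
  refine ⟨f.continuous.locallyIntegrable, hdc.locallyIntegrable, fun φ hφ hc => ?_⟩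
  have hdφ : Continuous (deriv φ) := hφ.continuous_deriv (by simp)
  have hφd : ∀ x, HasDerivAt φ (deriv φ x) x := fun x =>
    (hφ.differentiable (by simp) x).hasDerivAt
  have key := integral_mul_deriv_eq_deriv_mul_of_integrable (u := fun x => (φ x : ℂ)) (v := f)
    (u' := fun x => ((deriv φ x : ℝ) : ℂ)) (v' := deriv f)
    (fun x _ => (hφd x).ofReal_comp) (fun x _ => hd x)
    (((Complex.continuous_ofReal.comp hφ.continuous).mul hdc).integrable_of_hasCompactSupport
      (hc.comp_left Complex.ofReal_zero).mul_right)
    (((Complex.continuous_ofReal.comp hdφ).mul f.continuous).integrable_of_hasCompactSupport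
      (hc.deriv.comp_left Complex.ofReal_zero).mul_right)
    (((Complex.continuous_ofReal.comp hφ.continuous).mul
      f.continuous).integrable_of_hasCompactSupport
      (hc.comp_left Complex.ofReal_zero).mul_right)
  simp only [Complex.real_smul]
  rw [key, neg_neg]

theorem SchwartzMap.memW1_toLp (f : 𝓢(ℝ, ℂ)) : MemW1 1 (f.toLp 1 : Lp ℂ 1 (volume : Measure ℝ)) :=
  ⟨Lp.memLp _, deriv f, f.hasWeakDeriv.congr (f.coeFn_toLp 1).symm,
    ((SchwartzMap.derivCLM ℝ ℂ f).memLp 1).ae_eq (Filter.Eventually.of_forall fun x =>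
      SchwartzMap.derivCLM_apply ℝ f x)⟩

theorem SchwartzMap.integrable_moment_toLp (f : 𝓢(ℝ, ℂ)) :
    Integrable (fun x : ℝ => x * ‖(f.toLp 1 : Lp ℂ 1 (volume : Measure ℝ)) x‖) := by
  refine (f.integrable_pow_mul volume 1).mono
    (aestronglyMeasurable_id.mul (Lp.aestronglyMeasurable _).norm) ?_
  filter_upwards [f.coeFn_toLp 1] with x hx
  simp [hx]

theorem theorem4 :
    (∀ n : ℕ, 2 ≤ n → ∀ V : Lp ℂ 1 (volume : Measure ℝ),
      Integrable (fun x : ℝ => ((1 + x ^ (2 * n) : ℝ) : ℂ) * V x) → MemW1 1 V →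
        ∃ ε₀ : ℝ, 0 < ε₀ ∧ ∃ C : ℝ, 0 < C ∧ ∀ ε : ℝ, 0 < ε → ε < ε₀ →
          pointSpectrum (perturbedOperator V ε) ⊆
            closure halfStrip ∩ {z : ℂ | C / ε ^ (2 * n) ≤ z.re}) ∧
    (∀ V : 𝓢(ℝ, ℂ), ∀ N : ℕ,
      ∃ ε₀ : ℝ, 0 < ε₀ ∧ ∃ C : ℝ, 0 < C ∧ ∀ ε : ℝ, 0 < ε → ε < ε₀ →
        ∀ l ∈ pointSpectrum (perturbedOperator (V.toLp 1) ε),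
          l ≠ 0 ∧ ‖l‖⁻¹ ≤ C * ε ^ N) := by
  refine ⟨fun n hn V hw hV => ?_, fun V N => ?_⟩
  · obtain ⟨ε₀, h0, h⟩ := exists_pointSpectrum_eq_empty V
      (integrable_moment_of_integrable_weight (by omega) hw) hV
    -- The set of eigenvalues is empty below `ε₀`, so any positive constant serves as `C`.
    refine ⟨ε₀, h0, 1, one_pos, fun ε hε hlt => ?_⟩
    rw [h ε hε hlt]
    exact empty_subset _
  · obtain ⟨ε₀, h0, h⟩ := exists_pointSpectrum_eq_empty (V.toLp 1 volume)
      V.integrable_moment_toLp V.memW1_toLp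
    refine ⟨ε₀, h0, 1, one_pos, fun ε hε hlt l hl => ?_⟩
    rw [h ε hε hlt] at hl
    exact absurd hl (notMem_empty l)
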